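/- Let $R$ be a discrete valuation ring with fraction field $K$ and residue field $k$, and let $\mathscr X \to \operatorname{Spec} R$ be a proper, regular, integral semistable curve (flat, with all geometric fibres reduced curves having at worst ordinary double points) whose generic fibre $X$ is a smooth geometrically integral curve over $K$. Let $\operatorname{Div}(X(K))$ be the group of divisors on $X$ supported on $K$-rational points. For $D \in \operatorname{Div}(X(K))$ let $\mathcal D$ be its closure in $\mathscr X$. Let $X_v$ ($v \in V$) be the irreducible components of the special fibre, and for a function $\varphi\colon V \to \mathbb Z$ (a twist) put $\mathcal O_{\mathscr X}(\mathcal D)(\varphi) = \mathcal O_{\mathscr X}\bigl(\mathcal D + \sum_v \varphi(v) X_v\bigr)$. Consider, for $D$ and one and the same twist $\varphi$, the conditions 1. $\mathcal O_{\mathscr X}(\mathcal D)(\varphi)$ has non-negative degree on every component $X_v$; 2. there are nonzero sections $s_v$ of $\mathcal O_{\mathscr X}(\mathcal D)(\varphi)|_{X_v}$ for all $v \in V$; 3. the sections $s_v$ agree at the common points of distinct components; 4. there is a global section of $\mathcal O_{\mathscr X}(\mathcal D)(\varphi)$ on $\mathscr X$ which restricts to $s_v$ on $X_v$ for every $v$.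 For $i = 1, 2, 3, 4$ say that $D$ satisfies steps $1$ to $i$ if there are a twist $\varphi$ and (for $i \ge 2$) sections $s_v$ for which the conditions $1, \dots, i$ hold. The rank $r_i(D)$ is $-1$ if $D$ does not satisfy steps $1$ to $i$; for $r \ge 0$, $r_i(D) = r$ if $D - E$ satisfies steps $1$ to $i$ for every effective $E \in \operatorname{Div}(X(K))$ of degree $r$, but not for some effective $E \in \operatorname{Div}(X(K))$ of degree $r + 1$. In other words, $r_i(D) + 1$ is the least degree of an effective $E \in \operatorname{Div}(X(K))$ such that $D - E$ does not satisfy steps $1$ to $i$ ($r_i(D)=\infty$ if there were no such $E$). Write $r_{\mathrm{num}}, r_{\mathrm{ab}}, r_{\mathrm{toric}}, r_X$ for $r_1, r_2, r_3, r_4$. Suppose that $X(K)$ is infinite. Then for every $D \in \operatorname{Div}(X(K))$ the space $H^0(X, \mathcal O_X(D))$ is finite-dimensional over $K$ and $$r_X(D) = \dim_K H^0(X, \mathcal O_X(D)) - 1 .$$ Consequently $$r_{\mathrm{num}}(D) \ \ge\ r_{\mathrm{ab}}(D) \ \ge\ r_{\mathrm{toric}}(D) \ \ge\ r_X(D) =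 \dim_K H^0(X, \mathcal O_X(D)) - 1 .$$ -/

import Mathlib

open CategoryTheory Limits AlgebraicGeometry

universe u

namespace GeomRank

noncomputable section

/-! ### Divisors and the sheaves `𝒪(A)` on a regular integral scheme -/

section Divisors

/-- A scheme all of whose local rings are regular. -/
class IsRegularScheme (Y : Scheme.{u}) : Prop where
  regular : ∀ y : Y, IsRegularLocalRing (Y.presheaf.stalk y)

variable {Y : Scheme.{u}} [IsIntegral Y] [IsLocallyNoetherian Y] [IsRegularScheme Y]

theorem isDiscreteValuationRing_stalk (z : Y) (hz : Order.coheight z = 1) :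
    IsDiscreteValuationRing (Y.presheaf.stalk z) := by
  have := IsRegularScheme.regular z
  have h1 := (IsRegularLocalRing.iff_finrank_cotangentSpace (Y.presheaf.stalk z)).mp this
  rw [ringKrullDim_stalk_eq_coheight, hz] at h1
  exact (IsLocalRing.finrank_CotangentSpace_eq_one_iff).mp (by exact_mod_cast h1)

/-- A Weil divisor on `Y` is written as a function `A : Y → ℤ` on points; only its values at points
of codimension one (the generic points of prime divisors) matter.  `stalkO A x` is the stalk at `x`
of `𝒪_Y(A)`, seen inside the function field: the rational functions `g` such that `div g + A` is
effective near `x`, that is, along all prime divisors through `x`. -/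
def stalkO (A : Y → ℤ) (x : Y) : Submodule (Y.presheaf.stalk x) Y.functionField where
  carrier := {g | g ≠ 0 → ∀ z : Y, z ⤳ x → Order.coheight z = 1 → 0 ≤ Scheme.ord g z + A z}
  zero_mem' := fun h => absurd rfl h
  add_mem' := by
    intro a b ha hb hab z hzx hz
    have := isDiscreteValuationRing_stalk z hz
    by_cases ha0 : a = 0
    · subst ha0; rw [zero_add] at hab ⊢; exact hb hab z hzx hz
    by_cases hb0 : b = 0
    · subst hb0; rw [add_zero] at hab ⊢; exact ha hab z hzx hz
    have h1 := ha ha0 z hzx hz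
    have h2 := hb hb0 z hzx hz
    have h3 := Scheme.ord_add (x := z) hab
    rcases min_le_iff.mp h3 with h | h <;> linarith
  smul_mem' := by
    intro c g hg hcg z hzx hz
    obtain ⟨U, hxU, a, rfl⟩ := Y.presheaf.exists_germ_eq c
    have hne : Nonempty U := ⟨⟨x, hxU⟩⟩
    have hzU : z ∈ U := hzx.mem_open U.isOpen hxU
    have hg0 : g ≠ 0 := by rintro rfl; simp at hcg
    have ha0 : a ≠ 0 := by rintro rfl; simp at hcg
    have key : (Y.presheaf.germ U x hxU a) • g = a • g := by
      rw [Algebra.smul_def, Algebra.smul_def, Scheme.algebraMap_germ_eq_germToFunctionField]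
      rfl
    have h1 := hg hg0 z hzx hz
    have h2 := Scheme.ord_le_smul hzU ha0 g
    rw [key]
    linarith

/-- For `v ⤳ x`: the prime ideal of `𝒪_{Y,x}` defining the reduced closed subscheme with
generic point `v`. -/
def primeAt {Y : Scheme.{u}} {v x : Y} (h : v ⤳ x) : Ideal (Y.presheaf.stalk x) :=
  (IsLocalRing.maximalIdeal (Y.presheaf.stalk v)).comap (Y.presheaf.stalkSpecializes h).hom

theorem primeAt_le {Y : Scheme.{u}} {v x : Y} (h : v ⤳ x) :
    primeAt h ≤ IsLocalRing.maximalIdeal (Y.presheaf.stalk x) :=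
  IsLocalRing.le_maximalIdeal (Ideal.comap_ne_top _ (Ideal.IsPrime.ne_top inferInstance))

/-- The stalk at `x` of the restriction of `𝒪_Y(A)` to the reduced closed subscheme `Z` with
generic point `v`, namely `𝒪_Y(A)_x / I_{Z,x} 𝒪_Y(A)_x`. -/
abbrev StalkRestrict (A : Y → ℤ) {v x : Y} (h : v ⤳ x) : Type u :=
  stalkO A x ⧸ (primeAt h • (⊤ : Submodule (Y.presheaf.stalk x) (stalkO A x)))

/-- The fibre `𝒪_Y(A) ⊗ κ(x)`. -/
abbrev Fibre (A : Y → ℤ) (x : Y) : Type u :=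
  stalkO A x ⧸ (IsLocalRing.maximalIdeal (Y.presheaf.stalk x) •
    (⊤ : Submodule (Y.presheaf.stalk x) (stalkO A x)))

/-- The value in the fibre at `x` of an element of the stalk of the restriction. -/
def toFibre (A : Y → ℤ) {v x : Y} (h : v ⤳ x) : StalkRestrict A h → Fibre A x :=
  Submodule.factor (Submodule.smul_mono_left (primeAt_le h))

/-- A global section of `𝒪_Y(A)|_Z`, where `Z` is the reduced closed subscheme with generic
point `v`: a family of elements of the stalks which is locally induced by sections of
`𝒪_Y(A)` over open subsets of `Y`. -/
structure RestrictedSection (A : Y → ℤ) (v : Y) where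
  val : ∀ (x : Y) (h : v ⤳ x), StalkRestrict A h
  isLocal : ∀ x : Y, v ⤳ x → ∃ U : Y.Opens, x ∈ U ∧ ∃ g : Y.functionField,
    ∀ y ∈ U, ∃ hg : g ∈ stalkO A y, ∀ h : v ⤳ y, val y h = Submodule.Quotient.mk ⟨g, hg⟩

/-- The rational function `g` induces a nonzero rational section of `𝒪_Y(A)|_Z`, whose order of
vanishing at `x ∈ Z` is `n`: if `e` generates `𝒪_Y(A)_x`, then `g = (a / b) e` for some
`a, b ∈ 𝒪_{Y,x}` not vanishing along `Z`, and `n` is the order of `a|_Z` minus that of `b|_Z`. -/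
def HasOrderAt (A : Y → ℤ) {v x : Y} (h : v ⤳ x) (g : Y.functionField) (n : ℤ) : Prop :=
  ∃ e : Y.functionField, stalkO A x = Submodule.span (Y.presheaf.stalk x) {e} ∧
    ∃ a b : Y.presheaf.stalk x, a ∉ primeAt h ∧ b ∉ primeAt h ∧ b • g = a • e ∧
      n = ((Ring.ord (Y.presheaf.stalk x ⧸ primeAt h) (Ideal.Quotient.mk _ a)).toNat : ℤ) -
        ((Ring.ord (Y.presheaf.stalk x ⧸ primeAt h) (Ideal.Quotient.mk _ b)).toNat : ℤ)

end Divisors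

/-! ### Semistable curves and regular semistable models -/

/-- The local ring of a curve over an algebraically closed field `k` is that of an ordinary double
point: its completion is isomorphic to `k[[x, y]] / (x y)`. -/
def IsOrdinaryDoublePoint (k : Type u) [Field k] (A : Type u) [CommRing A] [IsLocalRing A] : Prop :=
  Nonempty (AdicCompletion (IsLocalRing.maximalIdeal A) A ≃+*
    (MvPowerSeries (Fin 2) k ⧸
      Ideal.span {(MvPowerSeries.X 0 * MvPowerSeries.X 1 : MvPowerSeries (Fin 2) k)}))

/-- A semistable curve over `S`: flat, and every geometric fibre is a reduced curve (of dimension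
one at each closed point) whose closed points are regular points or ordinary double points. -/
structure IsSemistable {X S : Scheme.{u}} (f : X ⟶ S) : Prop where
  flat : Flat f
  reduced : ∀ (k : Type u) [Field k] [IsAlgClosed k] (s : Spec (.of k) ⟶ S),
    IsReduced (pullback f s)
  nodal : ∀ (k : Type u) [Field k] [IsAlgClosed k] (s : Spec (.of k) ⟶ S)
    (x : (pullback f s : Scheme.{u})), IsClosed ({x} : Set (pullback f s : Scheme.{u})) →
      ringKrullDim ((pullback f s).presheaf.stalk x) = 1 ∧
      (IsRegularLocalRing ((pullback f s).presheaf.stalk x) ∨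
        IsOrdinaryDoublePoint k ((pullback f s).presheaf.stalk x))

/-- A proper regular semistable model, over a discrete valuation ring `R` with fraction field `K`,
of a smooth geometrically integral curve over `K`. -/
structure RegularSemistableModel (R K : Type u) [CommRing R] [IsDomain R]
    [IsDiscreteValuationRing R] [Field K] [Algebra R K] [IsFractionRing R K] where
  /-- the total space -/
  X : Scheme.{u}
  /-- the structure morphism -/
  f : X ⟶ Spec (.of R)
  isIntegral : IsIntegral X
  isProper : IsProper f
  isRegular : IsRegularScheme X
  isSemistable : IsSemistable f
  smooth_generic :
    SmoothOfRelativeDimension 1 (pullback.snd f (Spec.map (CommRingCat.ofHom (algebraMap R K))))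
  geometricallyIntegral_generic :
    GeometricallyIntegral (pullback.snd f (Spec.map (CommRingCat.ofHom (algebraMap R K))))

namespace RegularSemistableModel

variable {R K : Type u} [CommRing R] [IsDomain R] [IsDiscreteValuationRing R] [Field K]
  [Algebra R K] [IsFractionRing R K] (M : RegularSemistableModel R K)

instance : IsIntegral M.X := M.isIntegral
instance : IsRegularScheme M.X := M.isRegular
instance : IsLocallyNoetherian M.X :=
  haveI := M.isProper
  LocallyOfFiniteType.isLocallyNoetherian M.f

/-- The generic fibre. -/
def genericFibre : Scheme.{u} :=
  pullback M.f (Spec.map (CommRingCat.ofHom (algebraMap R K)))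

/-- The inclusion of the generic fibre into the model. -/
def ι : M.genericFibre ⟶ M.X := pullback.fst _ _

/-- The structure morphism of the generic fibre. -/
def toSpecK : M.genericFibre ⟶ Spec (.of K) := pullback.snd _ _

instance : IsIntegral M.genericFibre :=
  haveI : GeometricallyIntegral M.toSpecK := M.geometricallyIntegral_generic
  GeometricallyIntegral.isIntegral_of_subsingleton M.toSpecK

instance : IsLocallyNoetherian M.genericFibre :=
  haveI := M.isProper
  haveI : LocallyOfFiniteType M.toSpecK :=
    inferInstanceAs (LocallyOfFiniteType
      (pullback.snd M.f (Spec.map (CommRingCat.ofHom (algebraMap R K)))))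
  LocallyOfFiniteType.isLocallyNoetherian M.toSpecK

theorem isLocalization_away_of_irreducible (R K : Type u) [CommRing R] [IsDomain R]
    [IsDiscreteValuationRing R] [Field K] [Algebra R K] [IsFractionRing R K] (ϖ : R)
    (hϖ : Irreducible ϖ) : IsLocalization.Away ϖ K := by
  refine (IsLocalization.iff_of_le_of_exists_dvd (S := K) (Submonoid.powers ϖ) (nonZeroDivisors R)
    (powers_le_nonZeroDivisors_of_noZeroDivisors hϖ.ne_zero) fun n hn => ?_).mpr inferInstance
  obtain ⟨k, hk⟩ := IsDiscreteValuationRing.associated_pow_irreducible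
    (nonZeroDivisors.ne_zero hn) hϖ
  exact ⟨ϖ ^ k, ⟨k, rfl⟩, hk.dvd⟩

instance : IsOpenImmersion M.ι := by
  obtain ⟨ϖ, hϖ⟩ := IsDiscreteValuationRing.exists_irreducible R
  have := isLocalization_away_of_irreducible R K ϖ hϖ
  have : IsOpenImmersion (Spec.map (CommRingCat.ofHom (algebraMap R K))) :=
    IsOpenImmersion.of_isLocalization ϖ
  exact MorphismProperty.pullback_fst _ _ this

instance : IsRegularScheme M.genericFibre where
  regular y :=
    haveI := M.isRegular.regular (M.ι y)
    IsRegularLocalRing.of_ringEquiv (asIso (M.ι.stalkMap y)).commRingCatIsoToRingEquiv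

/-- The function field of the generic fibre is an extension of `K`. -/
instance : Algebra K M.genericFibre.functionField :=
  ((Scheme.ΓSpecIso (.of K)).inv ≫ M.toSpecK.appTop ≫
    M.genericFibre.presheaf.germ ⊤ (genericPoint M.genericFibre) (Set.mem_univ _)).hom.toAlgebra

/-- The set of `K`-points of the generic fibre. -/
def Points : Type u := {P : Spec (.of K) ⟶ M.genericFibre // P ≫ M.toSpecK = 𝟙 _}

/-- The group of divisors on the generic fibre supported on `K`-points. -/
abbrev Div : Type u := M.Points →₀ ℤ

variable {M}

/-- The point of the generic fibre underlying a `K`-point. -/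
def Points.pt (P : M.Points) : M.genericFibre := P.1 (IsLocalRing.closedPoint K)

open Classical in
/-- A divisor supported on `K`-points as a Weil divisor on the generic fibre. -/
def genericDivisor (D : M.Div) : M.genericFibre → ℤ :=
  fun z => D.sum fun P n => if P.pt = z then n else 0

open Classical in
/-- The closure on the model of a divisor supported on `K`-points: the point `P` of the generic
fibre becomes the prime divisor of the model with generic point `P`. -/
def closure (D : M.Div) : M.X → ℤ :=
  fun z => D.sum fun P n => if M.ι P.pt = z then n else 0

/-- `H⁰` of the generic fibre with values in `𝒪(D)`, as a `K`-vector space of rational functions. -/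
def H0 (D : M.Div) : Submodule K M.genericFibre.functionField where
  carrier := {g | ∀ x, g ∈ stalkO (genericDivisor D) x}
  zero_mem' := fun x => zero_mem _
  add_mem' := fun ha hb x => add_mem (ha x) (hb x)
  smul_mem' := by
    intro c g hg x
    have hx : x ∈ (⊤ : M.genericFibre.Opens) := Set.mem_univ _
    have hne : Nonempty (⊤ : M.genericFibre.Opens) := ⟨⟨x, hx⟩⟩
    have h : c • g = (M.genericFibre.presheaf.germ ⊤ x hx
        (((Scheme.ΓSpecIso (.of K)).inv ≫ M.toSpecK.appTop) c)) • g := by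
      rw [Algebra.smul_def, Algebra.smul_def, Scheme.algebraMap_germ_eq_germToFunctionField]
      rfl
    rw [h]
    exact Submodule.smul_mem _ _ (hg x)

variable (M)

/-- `v` is the generic point of an irreducible component of the special fibre. -/
def IsComponent (v : M.X) : Prop :=
  M.f v = IsLocalRing.closedPoint R ∧
    ∀ w : M.X, M.f w = IsLocalRing.closedPoint R → w ⤳ v → w = v

/-- The irreducible components of the special fibre (the vertices of the dual graph), given by
their generic points. -/
def Component : Type u := {v : M.X // M.IsComponent v}

variable {M}

open Classical in
/-- The twist `V_φ = ∑ φ(v) X_v`. -/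
def twist (φ : M.Component → ℤ) : M.X → ℤ :=
  fun z => if h : M.IsComponent z then φ ⟨z, h⟩ else 0

/-- The degree of `𝒪(A)` on the component `X_v` is `d`: some nonzero rational section of
`𝒪(A)|_{X_v}` has a divisor `∑ n_x x` of degree `d = ∑ n_x [κ(x) : k]`, where `k` is the residue
field of `R`.  (The degree does not depend on the rational section, as `X_v` is proper.) -/
def HasDegree (A : M.X → ℤ) (v : M.Component) (d : ℤ) : Prop :=
  ∃ (g : M.X.functionField) (n : {x : M.X // v.1 ⤳ x ∧ IsClosed ({x} : Set M.X)} →₀ ℤ),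
    (∀ x, HasOrderAt A x.2.1 g (n x)) ∧
    d = n.sum fun x m => m * (M.f.residueDegree x.1 : ℤ)

/-- A family of sections of `𝒪(A)|_{X_v}`, one for each component `X_v`. -/
abbrev SectionFamily (A : M.X → ℤ) : Type u :=
  ∀ v : M.Component, RestrictedSection A v.1

/-- (1) `𝒪(A)` has nonnegative degree on every component of the special fibre. -/
def NonnegDegrees (A : M.X → ℤ) : Prop :=
  ∀ v : M.Component, ∃ d : ℤ, 0 ≤ d ∧ HasDegree A v d

/-- (2) None of the sections `s_v` of `𝒪(A)|_{X_v}` is the zero section. -/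
def SectionFamily.Nonzero {A : M.X → ℤ} (s : SectionFamily A) : Prop :=
  ∀ v : M.Component, ∃ (x : M.X) (h : v.1 ⤳ x), (s v).val x h ≠ 0

/-- (3) The sections `s_v` agree across nodes: at any common point of two components,
they take the same value. -/
def SectionFamily.AgreeAtNodes {A : M.X → ℤ} (s : SectionFamily A) : Prop :=
  ∀ (v w : M.Component) (x : M.X) (hv : v.1 ⤳ x) (hw : w.1 ⤳ x),
    toFibre A hv ((s v).val x hv) = toFibre A hw ((s w).val x hw)

/-- (4) The section formed from the `s_v` extends to a global section of `𝒪(A)` on the model. -/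
def SectionFamily.Extends {A : M.X → ℤ} (s : SectionFamily A) : Prop :=
  ∃ (g : M.X.functionField) (hg : ∀ x : M.X, g ∈ stalkO A x),
    ∀ (v : M.Component) (x : M.X) (h : v.1 ⤳ x),
      (s v).val x h = Submodule.Quotient.mk ⟨g, hg x⟩

/-- `D` satisfies step (1). -/
def SatisfiesNum (D : M.Div) : Prop :=
  ∃ φ : M.Component → ℤ, NonnegDegrees (closure D + twist φ)

/-- `D` satisfies steps (1) and (2). -/
def SatisfiesAb (D : M.Div) : Prop :=
  ∃ φ : M.Component → ℤ, NonnegDegrees (closure D + twist φ) ∧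
    ∃ s : SectionFamily (closure D + twist φ), s.Nonzero

/-- `D` satisfies steps (1) to (3). -/
def SatisfiesToric (D : M.Div) : Prop :=
  ∃ φ : M.Component → ℤ, NonnegDegrees (closure D + twist φ) ∧
    ∃ s : SectionFamily (closure D + twist φ), s.Nonzero ∧ s.AgreeAtNodes

/-- `D` satisfies steps (1) to (4). -/
def SatisfiesX (D : M.Div) : Prop :=
  ∃ φ : M.Component → ℤ, NonnegDegrees (closure D + twist φ) ∧
    ∃ s : SectionFamily (closure D + twist φ), s.Nonzero ∧ s.AgreeAtNodes ∧ s.Extends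

/-- The degree of a divisor supported on `K`-points. -/
def deg (D : M.Div) : ℤ := D.sum fun _ n => n

/-- "The rank of `D` with respect to the condition `S` is `r`": `r = -1` and `D` fails `S`; or
`r ≥ 0`, `D - E` satisfies `S` for every effective `E` of degree `r`, and `D - E` fails `S` for
some effective `E` of degree `r + 1`. -/
def HasRank (S : M.Div → Prop) (D : M.Div) (r : ℤ) : Prop :=
  (r = -1 ∧ ¬ S D) ∨
    (0 ≤ r ∧ (∀ E : M.Div, 0 ≤ E → deg E = r → S (D - E)) ∧
      ∃ E : M.Div, 0 ≤ E ∧ deg E = r + 1 ∧ ¬ S (D - E))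

/-- The rank of `D` with respect to the condition `S`, as an extended number: one less than the
least degree of an effective `E` such that `D - E` fails `S`. -/
def rank (S : M.Div → Prop) (D : M.Div) : EReal :=
  ⨅ E : {E : M.Div // 0 ≤ E ∧ ¬ S (D - E)}, (((deg E.1 - 1 : ℤ) : ℝ) : EReal)

/-- The numerical rank. -/
def rNum (D : M.Div) : EReal := rank SatisfiesNum D

/-- The abelian rank. -/
def rAb (D : M.Div) : EReal := rank SatisfiesAb D

/-- The toric rank. -/
def rToric (D : M.Div) : EReal := rank SatisfiesToric D

/-- The finest geometric rank `r_X`. -/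
def rX (D : M.Div) : EReal := rank SatisfiesX D

end RegularSemistableModel

end

end GeomRank

/-!
A nonzero `g ∈ H⁰(X, 𝒪(D))` becomes, after twisting by `φ(v) = -ord_v g`, a section of
`𝒪(𝒟)(φ)` whose divisor contains no component of the special fibre, so `D` satisfies all four
steps; conversely the global section of step (4) restricts to a nonzero element of `H⁰(X, 𝒪(D))`.
Hence `D` satisfies steps (1) to (4) if and only if `h⁰(D) > 0`. Subtracting a rational point
lowers `h⁰` by at most one, and by exactly one at any of the infinitely many rational points which
are neither in the support of `D` nor zeros or poles of a given nonzero section. So `h⁰(D)` is the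
least degree of an effective `E` with `h⁰(D - E) = 0`.

The orders of `g` control its behaviour as a section of `𝒪(𝒟)(φ)` because the model is regular of
dimension at most two: its local rings are factorial, so an element of the function field without
poles of codimension one is regular.
-/

namespace GeomRank

section Algebra

open IsLocalRing

/- If `f ∈ p` generates `p` modulo `x`, then `p ≤ (f) + x p` because `x ∉ p`, and Nakayama's lemma
applies. -/
theorem isPrincipal_of_isPrincipal_map_mk {A : Type*} [CommRing A] [IsLocalRing A] {x : A}
    (hx : x ∈ maximalIdeal A) {p : Ideal A} [hp : p.IsPrime] (hfg : p.FG) (hxp : x ∉ p)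
    (h : (p.map (Ideal.Quotient.mk (Ideal.span {x}))).IsPrincipal) : p.IsPrincipal := by
  obtain ⟨f', hf'⟩ := h
  obtain ⟨f, hfp, rfl⟩ : ∃ f ∈ p, Ideal.Quotient.mk (Ideal.span {x}) f = f' :=
    (Ideal.mem_map_iff_of_surjective _ Ideal.Quotient.mk_surjective).mp
      (hf' ▸ Submodule.mem_span_singleton_self f')
  refine ⟨f, le_antisymm (Submodule.le_of_le_smul_of_le_jacobson_bot (I := maximalIdeal A) hfg
    (maximalIdeal_le_jacobson _) fun a ha => ?_) (by simpa [Ideal.span_le] using hfp)⟩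
  have ha' := hf' ▸ Ideal.mem_map_of_mem (Ideal.Quotient.mk (Ideal.span {x})) ha
  obtain ⟨r', hr⟩ := Submodule.mem_span_singleton.mp ha'
  obtain ⟨r, rfl⟩ := Ideal.Quotient.mk_surjective r'
  rw [smul_eq_mul, ← map_mul, eq_comm, Ideal.Quotient.eq, Ideal.mem_span_singleton'] at hr
  obtain ⟨b, hb⟩ := hr
  have hbp : b ∈ p := by
    refine (hp.mem_or_mem ?_).resolve_right hxp
    rw [hb]
    exact p.sub_mem ha (p.mul_mem_left r hfp)
  rw [← sub_add_cancel a (r * f), ← hb, add_comm, mul_comm b]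
  exact Submodule.add_mem_sup (Submodule.mem_span_singleton.mpr ⟨r, rfl⟩)
    (Submodule.smul_mem_smul hx hbp)

theorem isPrincipalIdealRing_of_isPrincipal_maximalIdeal {A : Type*} [CommRing A] [IsLocalRing A]
    [IsNoetherianRing A] (h : (maximalIdeal A).IsPrincipal) : IsPrincipalIdealRing A := by
  obtain ⟨y, hy⟩ := id h
  refine .of_prime fun q hq => ?_
  have hqm : q ≤ maximalIdeal A := le_maximalIdeal hq.ne_top
  by_cases hyq : y ∈ q
  · rwa [hqm.antisymm (by rw [hy]; simpa [Ideal.span_le] using hyq)]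
  · refine isPrincipal_of_isPrincipal_map_mk (hy ▸ Submodule.mem_span_singleton_self y)
      (IsNoetherian.noetherian q) hyq ?_
    rw [(Ideal.map_eq_bot_iff_le_ker _).mpr (by rw [Ideal.mk_ker]; exact hqm.trans hy.le)]
    exact bot_isPrincipal

theorem map_maximalIdeal_of_surjective {A B : Type*} [CommRing A] [IsLocalRing A] [CommRing B]
    [IsLocalRing B] {φ : A →+* B} (hφ : Function.Surjective φ) :
    (maximalIdeal A).map φ = maximalIdeal B := by
  have := IsLocalHom.of_surjective φ hφ
  rw [← maximalIdeal_comap φ, Ideal.map_comap_of_surjective φ hφ]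

theorem isPrincipal_of_maximalIdeal_eq_span_pair {A : Type*} [CommRing A] [IsLocalRing A]
    [IsNoetherianRing A] {x y : A} (h : maximalIdeal A = Ideal.span {x, y}) {p : Ideal A}
    [hp : p.IsPrime] (hpm : p ≠ maximalIdeal A) : p.IsPrincipal := by
  wlog hx : x ∉ p generalizing x y
  · refine this (Set.pair_comm x y ▸ h) fun hy => hpm (le_antisymm (le_maximalIdeal hp.ne_top) ?_)
    rw [h, Ideal.span_le, Set.pair_subset_iff]
    exact ⟨not_not.mp hx, hy⟩
  have hxm : x ∈ maximalIdeal A := h ▸ Ideal.subset_span (Set.mem_insert x {y})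
  have : Nontrivial (A ⧸ Ideal.span {x}) := Ideal.Quotient.nontrivial_iff.mpr fun e =>
    (mem_maximalIdeal x).mp hxm (Ideal.span_singleton_eq_top.mp e)
  have : IsLocalRing (A ⧸ Ideal.span {x}) :=
    .of_surjective' (Ideal.Quotient.mk _) Ideal.Quotient.mk_surjective
  have hmax : maximalIdeal (A ⧸ Ideal.span {x}) = Ideal.span {Ideal.Quotient.mk _ y} := by
    rw [← map_maximalIdeal_of_surjective Ideal.Quotient.mk_surjective, h, Ideal.map_span,
      Set.image_pair, Ideal.Quotient.eq_zero_iff_mem.mpr (Ideal.mem_span_singleton_self x),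
      Ideal.span_insert_zero]
  have := isPrincipalIdealRing_of_isPrincipal_maximalIdeal ⟨_, hmax⟩
  exact isPrincipal_of_isPrincipal_map_mk hxm (IsNoetherian.noetherian p) hx
    (IsPrincipalIdealRing.principal _)

theorem exists_maximalIdeal_eq_span_pair {A : Type*} [CommRing A] [IsRegularLocalRing A]
    (h : ringKrullDim A ≤ 2) : ∃ x y : A, maximalIdeal A = Ideal.span {x, y} := by
  classical
  have hle : (maximalIdeal A).spanFinrank ≤ 2 := by
    rw [← IsRegularLocalRing.spanFinrank_maximalIdeal] at h
    exact_mod_cast h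
  obtain ⟨s, hcard, hs⟩ := (IsNoetherian.noetherian
    (maximalIdeal A)).exists_span_finset_card_eq_spanFinrank
  rw [← hs]
  rw [← hcard] at hle
  interval_cases hn : s.card
  · exact ⟨0, 0, by rw [Finset.card_eq_zero.mp hn]; simp⟩
  · obtain ⟨x, rfl⟩ := Finset.card_eq_one.mp hn
    exact ⟨x, x, by simp⟩
  · obtain ⟨x, y, -, rfl⟩ := Finset.card_eq_two.mp hn
    exact ⟨x, y, by simp⟩

/- A height-one prime is principal: if it is maximal, the ring is a discrete valuation ring. -/
theorem uniqueFactorizationMonoid_of_ringKrullDim_le_two (A : Type*) [CommRing A] [IsDomain A]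
    [IsRegularLocalRing A] (h : ringKrullDim A ≤ 2) : UniqueFactorizationMonoid A := by
  obtain ⟨x, y, hxy⟩ := exists_maximalIdeal_eq_span_pair h
  refine .of_forall_isPrincipal_of_height_eq_one fun p hp hph => ?_
  by_cases hpm : p = maximalIdeal A
  · have hdim := (IsRegularLocalRing.iff_finrank_cotangentSpace A).mp inferInstance
    rw [← maximalIdeal_height_eq_ringKrullDim, (hpm ▸ hph : (maximalIdeal A).height = 1)] at hdim
    rw [hpm, ← finrank_cotangentSpace_le_one_iff]
    exact_mod_cast hdim.le
  · exact isPrincipal_of_maximalIdeal_eq_span_pair hxy hpm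

theorem ordFrac_ringEquiv {A B K L : Type*} [CommRing A] [IsDomain A] [IsDiscreteValuationRing A]
    [CommRing B] [IsDomain B] [IsDiscreteValuationRing B] [Field K] [Field L] [Algebra A K]
    [IsFractionRing A K] [Algebra B L] [IsFractionRing B L] (e : A ≃+* B) (F : K →+* L)
    (hF : ∀ a, F (algebraMap A K a) = algebraMap B L (e a)) (g : K) :
    Ring.ordFrac B (F g) = Ring.ordFrac A g := by
  have ord_integer (a : A) :
      Ring.ordFrac B (F (algebraMap A K a)) = Ring.ordFrac A (algebraMap A K a) := by
    by_cases ha : a = 0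
    · simp [ha]
    obtain ⟨ϖ, hϖ⟩ := IsDiscreteValuationRing.exists_irreducible A
    obtain ⟨n, u, rfl⟩ := IsDiscreteValuationRing.eq_unit_mul_pow_irreducible ha hϖ
    have heϖ : Irreducible (e ϖ) := (MulEquiv.irreducible_iff e).mpr hϖ
    have heu : IsUnit (e u) := u.isUnit.map e
    simp only [hF, map_mul, map_pow, Ring.ordFrac_irreducible hϖ, Ring.ordFrac_irreducible heϖ,
      Ring.ordFrac_of_isUnit heu, Ring.ordFrac_of_isUnit u.isUnit]
  obtain ⟨a, b, -, rfl⟩ := IsFractionRing.div_surjective (A := A) g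
  simp only [map_div₀, ord_integer]

theorem mem_asIdeal_iff_eq_closedPoint {R : Type*} [CommRing R] [IsDomain R]
    [IsDiscreteValuationRing R] {ϖ : R} (hϖ : Irreducible ϖ) (p : PrimeSpectrum R) :
    ϖ ∈ p.asIdeal ↔ p = IsLocalRing.closedPoint R := by
  constructor
  · intro h
    refine PrimeSpectrum.ext (le_antisymm (IsLocalRing.le_maximalIdeal p.2.ne_top) ?_)
    change IsLocalRing.maximalIdeal R ≤ _
    rw [(IsDiscreteValuationRing.irreducible_iff_uniformizer ϖ).mp hϖ]
    exact (Ideal.span_singleton_le_iff_mem _).mpr h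
  · rintro rfl
    exact (IsLocalRing.mem_maximalIdeal _).mpr hϖ.not_isUnit

end Algebra

section Generizations

variable {Y : Scheme.{u}}

instance primeAt_isPrime {v x : Y} (h : v ⤳ x) : (primeAt h).IsPrime :=
  Ideal.IsPrime.comap _

theorem mem_primeAt_iff {v x : Y} (h : v ⤳ x) {a : Y.presheaf.stalk x} :
    a ∈ primeAt h ↔ ¬ IsUnit ((Y.presheaf.stalkSpecializes h).hom a) :=
  IsLocalRing.mem_maximalIdeal _

theorem notMem_primeAt_iff {v x : Y} (h : v ⤳ x) {a : Y.presheaf.stalk x} :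
    a ∉ primeAt h ↔ IsUnit ((Y.presheaf.stalkSpecializes h).hom a) :=
  (mem_primeAt_iff h).not_left

theorem stalkSpecializes_trans_apply {w z x : Y} (h : w ⤳ z) (h' : z ⤳ x)
    (a : Y.presheaf.stalk x) :
    (Y.presheaf.stalkSpecializes h).hom ((Y.presheaf.stalkSpecializes h').hom a) =
      (Y.presheaf.stalkSpecializes (h.trans h')).hom a := by
  rw [← Y.presheaf.stalkSpecializes_comp h h']
  rfl

theorem primeAt_refl (x : Y) :
    primeAt (specializes_rfl : x ⤳ x) = IsLocalRing.maximalIdeal (Y.presheaf.stalk x) := by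
  ext a
  rw [primeAt, Y.presheaf.stalkSpecializes_refl]
  rfl

theorem fromSpecStalk_primeAt {z x : Y} (h : z ⤳ x) :
    Y.fromSpecStalk x ⟨primeAt h, inferInstance⟩ = z := by
  have hz := Scheme.fromSpecStalk_closedPoint (x := z)
  rwa [← Scheme.SpecMap_stalkSpecializes_fromSpecStalk h] at hz

theorem exists_primeAt_eq {x : Y} (q : Ideal (Y.presheaf.stalk x)) [hq : q.IsPrime] :
    ∃ (z : Y) (h : z ⤳ x), primeAt h = q := by
  have hz : Y.fromSpecStalk x ⟨q, hq⟩ ⤳ x := by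
    have hrange : Y.fromSpecStalk x ⟨q, hq⟩ ∈ Set.range (Y.fromSpecStalk x) := ⟨_, rfl⟩
    rwa [Scheme.range_fromSpecStalk] at hrange
  exact ⟨_, hz, congrArg PrimeSpectrum.asIdeal
    ((Y.fromSpecStalk x).isEmbedding.injective (fromSpecStalk_primeAt hz))⟩

theorem primeAt_le_primeAt_iff {w z x : Y} (hw : w ⤳ x) (hz : z ⤳ x) :
    primeAt hw ≤ primeAt hz ↔ w ⤳ z := by
  refine ⟨fun h => ?_, fun h a ha => ?_⟩
  · have hspec : (⟨primeAt hw, inferInstance⟩ : PrimeSpectrum (Y.presheaf.stalk x)) ⤳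
        ⟨primeAt hz, inferInstance⟩ := (PrimeSpectrum.le_iff_specializes _ _).mp h
    have := hspec.map (Y.fromSpecStalk x).continuous
    erw [fromSpecStalk_primeAt, fromSpecStalk_primeAt] at this
    exact this
  · rw [mem_primeAt_iff] at ha ⊢
    rw [← stalkSpecializes_trans_apply h hz] at ha
    exact fun hu => ha (hu.map (Y.presheaf.stalkSpecializes h).hom)

theorem primeAt_inj {w z x : Y} {hw : w ⤳ x} {hz : z ⤳ x} :
    primeAt hw = primeAt hz ↔ w = z := by
  refine ⟨fun h => ?_, fun h => by subst h; rfl⟩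
  exact (((primeAt_le_primeAt_iff hw hz).mp h.le).antisymm
    ((primeAt_le_primeAt_iff hz hw).mp h.ge)).eq

theorem exists_stalkSpecializes_mul_eq {z x : Y} (h : z ⤳ x) (t : Y.presheaf.stalk z) :
    ∃ a s : Y.presheaf.stalk x, s ∉ primeAt h ∧
      (Y.presheaf.stalkSpecializes h).hom s * t = (Y.presheaf.stalkSpecializes h).hom a := by
  obtain ⟨_, ⟨U, hU, rfl⟩, hxU, -⟩ :=
    Y.isBasis_affineOpens.exists_subset_of_mem_open (Set.mem_univ x) isOpen_univ
  have hzU : z ∈ U := h.mem_open U.2 hxU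
  let := TopCat.Presheaf.algebra_section_stalk Y.presheaf (⟨z, hzU⟩ : U)
  have := hU.isLocalization_stalk ⟨z, hzU⟩
  obtain ⟨⟨a, s⟩, has⟩ := IsLocalization.surj (hU.primeIdealOf ⟨z, hzU⟩).asIdeal.primeCompl t
  have hgerm (b : Γ(Y, U)) : (Y.presheaf.stalkSpecializes h).hom (Y.presheaf.germ U x hxU b) =
      Y.presheaf.germ U z hzU b := by
    rw [← Y.presheaf.germ_stalkSpecializes hxU h]
    rfl
  refine ⟨Y.presheaf.germ U x hxU a, Y.presheaf.germ U x hxU s.1, ?_, ?_⟩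
  · rw [notMem_primeAt_iff, hgerm]
    exact IsLocalization.map_units (Y.presheaf.stalk z) s
  · rw [hgerm, hgerm, mul_comm]
    exact has

theorem map_primeAt {z x : Y} (h : z ⤳ x) :
    (primeAt h).map (Y.presheaf.stalkSpecializes h).hom =
      IsLocalRing.maximalIdeal (Y.presheaf.stalk z) := by
  refine le_antisymm Ideal.map_comap_le fun t ht => ?_
  obtain ⟨a, s, hs, hast⟩ := exists_stalkSpecializes_mul_eq h t
  have ha : a ∈ primeAt h := Ideal.mem_comap.mpr (hast ▸ Ideal.mul_mem_left _ _ ht)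
  rw [← Ideal.unit_mul_mem_iff_mem _ ((notMem_primeAt_iff h).mp hs), hast]
  exact Ideal.mem_map_of_mem _ ha

theorem lt_of_specializes_of_ne {w z : Y} (h : w ⤳ z) (hne : w ≠ z) : z < w :=
  lt_of_le_not_ge h fun h' => hne (h.antisymm h').eq

end Generizations

section CodimensionOne

variable {Y : Scheme.{u}} [IsIntegral Y]

theorem coheight_eq_zero_iff {z : Y} : Order.coheight z = 0 ↔ z = genericPoint Y := by
  refine ⟨fun h => ?_, by rintro rfl; exact Order.coheight_eq_zero.mpr isMax_top⟩
  have hle := Order.coheight_eq_zero.mp h (genericPoint_specializes z)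
  exact (Specializes.antisymm hle (genericPoint_specializes z)).eq

theorem coheight_eq_one_iff {z : Y} : Order.coheight z = 1 ↔
    z ≠ genericPoint Y ∧ ∀ w, w ⤳ z → w = z ∨ w = genericPoint Y := by
  constructor
  · refine fun h => ⟨fun e => ?_, fun w hw => or_iff_not_imp_left.mpr fun hwz => ?_⟩
    · rw [coheight_eq_zero_iff.mpr e] at h
      exact zero_ne_one h
    · have hle : Order.coheight w + 1 ≤ 0 + 1 := by
        simpa only [zero_add, h] using Order.coheight_add_one_le (lt_of_specializes_of_ne hw hwz)
      exact coheight_eq_zero_iff.mp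
        (le_zero_iff.mp ((ENat.add_le_add_iff_right ENat.one_ne_top).mp hle))
  · rintro ⟨hz, h⟩
    refine le_antisymm ((Order.coheight_le_coe_iff (n := 1)).mpr fun w hw => ?_)
      (Order.one_le_iff_ne_zero.mpr fun h0 => hz (coheight_eq_zero_iff.mp h0))
    rw [coheight_eq_zero_iff.mpr ((h w hw.le).resolve_left hw.ne')]
    exact Nat.cast_pos.mpr one_pos

theorem eq_of_specializes_of_coheight_eq_one {w z : Y} (h : w ⤳ z) (hw : Order.coheight w = 1)
    (hz : Order.coheight z = 1) : w = z :=
  ((coheight_eq_one_iff.mp hz).2 w h).resolve_right (coheight_eq_one_iff.mp hw).1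

theorem algebraMap_stalkSpecializes {z x : Y} (h : z ⤳ x) (a : Y.presheaf.stalk x) :
    algebraMap (Y.presheaf.stalk z) Y.functionField ((Y.presheaf.stalkSpecializes h).hom a) =
      algebraMap (Y.presheaf.stalk x) Y.functionField a :=
  stalkSpecializes_trans_apply _ h a

theorem algebraMap_ne_zero {x : Y} {a : Y.presheaf.stalk x} (ha : a ≠ 0) :
    algebraMap (Y.presheaf.stalk x) Y.functionField a ≠ 0 :=
  (map_ne_zero_iff _ (IsFractionRing.injective _ _)).mpr ha

theorem stalkSpecializes_injective {z x : Y} (h : z ⤳ x) :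
    Function.Injective (Y.presheaf.stalkSpecializes h).hom := fun a b hab =>
  IsFractionRing.injective (Y.presheaf.stalk x) Y.functionField (by
    rw [← algebraMap_stalkSpecializes h, hab, algebraMap_stalkSpecializes])

theorem stalkSpecializes_ne_zero {z x : Y} (h : z ⤳ x) {a : Y.presheaf.stalk x} (ha : a ≠ 0) :
    (Y.presheaf.stalkSpecializes h).hom a ≠ 0 :=
  (map_ne_zero_iff _ (stalkSpecializes_injective h)).mpr ha

theorem primeAt_eq_bot_iff {z x : Y} (h : z ⤳ x) : primeAt h = ⊥ ↔ z = genericPoint Y := by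
  have hη : primeAt (genericPoint_specializes x) = ⊥ := by
    refine (Submodule.eq_bot_iff _).mpr fun a ha => ?_
    by_contra ha0
    exact (mem_primeAt_iff _).mp ha
      (isUnit_iff_ne_zero.mpr (stalkSpecializes_ne_zero (genericPoint_specializes x) ha0))
  rw [← hη, primeAt_inj]

theorem uniqueFactorizationMonoid_stalk [IsRegularScheme Y] {x : Y}
    (hx : Order.coheight x ≤ 2) : UniqueFactorizationMonoid (Y.presheaf.stalk x) := by
  have := IsRegularScheme.regular x
  refine uniqueFactorizationMonoid_of_ringKrullDim_le_two _ ?_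
  rw [ringKrullDim_stalk_eq_coheight]
  exact WithBot.coe_le_coe.mpr hx

section Factorial

variable {x : Y} [UniqueFactorizationMonoid (Y.presheaf.stalk x)]

theorem exists_coheight_eq_one_of_prime {π : Y.presheaf.stalk x} (hπ : Prime π) :
    ∃ (z : Y) (h : z ⤳ x), Order.coheight z = 1 ∧ primeAt h = Ideal.span {π} := by
  have := (Ideal.span_singleton_prime hπ.ne_zero).mpr hπ
  obtain ⟨z, h, hz⟩ := exists_primeAt_eq (Ideal.span {π})
  refine ⟨z, h, coheight_eq_one_iff.mpr ⟨fun e => ?_, fun w hw => or_iff_not_imp_right.mpr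
    fun hne => ?_⟩, hz⟩
  · rw [(primeAt_eq_bot_iff h).mpr e, eq_comm, Ideal.span_singleton_eq_bot] at hz
    exact hπ.ne_zero hz
  · have hle : primeAt (hw.trans h) ≤ primeAt h := (primeAt_le_primeAt_iff _ h).mpr hw
    obtain ⟨ρ, hρw, hρ⟩ := Ideal.IsPrime.exists_mem_prime_of_ne_bot (primeAt_isPrime (hw.trans h))
      (mt (primeAt_eq_bot_iff _).mp hne)
    have hπρ : Associated π ρ :=
      hπ.associated_of_dvd hρ (Ideal.mem_span_singleton.mp (hz ▸ hle hρw))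
    refine primeAt_inj.mp (hle.antisymm ?_)
    rw [hz, Ideal.span_singleton_le_iff_mem]
    exact Ideal.mem_of_dvd _ hπρ.symm.dvd hρw

theorem exists_prime_primeAt_eq_span {z : Y} (h : z ⤳ x) (hz : Order.coheight z = 1) :
    ∃ π : Y.presheaf.stalk x, Prime π ∧ primeAt h = Ideal.span {π} := by
  obtain ⟨π, hπz, hπ⟩ := Ideal.IsPrime.exists_mem_prime_of_ne_bot (primeAt_isPrime h)
    (mt (primeAt_eq_bot_iff h).mp (coheight_eq_one_iff.mp hz).1)
  obtain ⟨w, hw, hw1, hwπ⟩ := exists_coheight_eq_one_of_prime hπ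
  have hwz : w ⤳ z := (primeAt_le_primeAt_iff hw h).mp (by
    rwa [hwπ, Ideal.span_singleton_le_iff_mem])
  obtain rfl := eq_of_specializes_of_coheight_eq_one hwz hw1 hz
  exact ⟨π, hπ, hwπ⟩

end Factorial

end CodimensionOne

section Order

variable {Y : Scheme.{u}} [IsIntegral Y] [IsLocallyNoetherian Y]

/-- The order of vanishing at `z`, as a homomorphism on the group of nonzero rational functions
(written additively, so that it can be evaluated on formal sums of local equations). -/
noncomputable def ordUnits (z : Y) : Additive Y.functionFieldˣ →+ ℤ :=
  AddMonoidHom.mk' (fun g => Scheme.ord (g.toMul : Y.functionField) z) fun f g => by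
    rw [toMul_add, Units.val_mul, Scheme.ord_mul f.toMul.ne_zero g.toMul.ne_zero]

theorem ordUnits_apply (z : Y) (g : Additive Y.functionFieldˣ) :
    ordUnits z g = Scheme.ord (g.toMul : Y.functionField) z :=
  rfl

theorem ord_one (z : Y) : Scheme.ord (1 : Y.functionField) z = 0 :=
  map_zero (ordUnits z)

theorem ord_inv {g : Y.functionField} (hg : g ≠ 0) (z : Y) :
    Scheme.ord g⁻¹ z = - Scheme.ord g z := by
  rw [eq_neg_iff_add_eq_zero, ← Scheme.ord_mul (inv_ne_zero hg) hg, inv_mul_cancel₀ hg, ord_one]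

theorem ord_smul {x : Y} {a : Y.presheaf.stalk x} {e : Y.functionField} (ha : a ≠ 0)
    (he : e ≠ 0) (z : Y) :
    Scheme.ord (a • e) z = Scheme.ord (algebraMap _ Y.functionField a) z + Scheme.ord e z := by
  rw [Algebra.smul_def, Scheme.ord_mul (algebraMap_ne_zero ha) he]

theorem ord_algebraMap_nonneg {z x : Y} (h : z ⤳ x) {a : Y.presheaf.stalk x} (ha : a ≠ 0) :
    0 ≤ Scheme.ord (algebraMap _ Y.functionField a) z := by
  by_cases hz : Order.coheight z = 1
  · have := krullDimLE_of_coheight_le hz.le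
    rw [Scheme.le_ord_iff hz (algebraMap_ne_zero ha), ← algebraMap_stalkSpecializes h]
    exact Ring.ordFrac_ge_one_of_ne_zero (stalkSpecializes_ne_zero h ha)
  · rw [Scheme.ord_eq_zero_of_coheight_neq_one hz]

variable [IsRegularScheme Y]

theorem ord_algebraMap_eq_zero_iff {z x : Y} (h : z ⤳ x) (hz : Order.coheight z = 1)
    {a : Y.presheaf.stalk x} (ha : a ≠ 0) :
    Scheme.ord (algebraMap _ Y.functionField a) z = 0 ↔ a ∉ primeAt h := by
  have := isDiscreteValuationRing_stalk z hz
  rw [Scheme.ord_eq_iff hz (algebraMap_ne_zero ha), notMem_primeAt_iff,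
    ← algebraMap_stalkSpecializes h]
  exact Ring.isUnit_iff_ordFrac_one_of_isDiscreteValuationRing.symm

theorem ord_algebraMap_ne_zero_iff {z x : Y} (h : z ⤳ x) (hz : Order.coheight z = 1)
    {a : Y.presheaf.stalk x} (ha : a ≠ 0) :
    Scheme.ord (algebraMap _ Y.functionField a) z ≠ 0 ↔ a ∈ primeAt h :=
  (ord_algebraMap_eq_zero_iff h hz ha).not_left

theorem ord_algebraMap_of_primeAt_eq_span {z x : Y} (h : z ⤳ x) (hz : Order.coheight z = 1)
    {π : Y.presheaf.stalk x} (hπ : primeAt h = Ideal.span {π}) :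
    Scheme.ord (algebraMap _ Y.functionField π) z = 1 := by
  have := isDiscreteValuationRing_stalk z hz
  have hirr : Irreducible ((Y.presheaf.stalkSpecializes h).hom π) := by
    rw [IsDiscreteValuationRing.irreducible_iff_uniformizer, ← map_primeAt h, hπ, Ideal.map_span,
      Set.image_singleton]
  rw [← algebraMap_stalkSpecializes h,
    Scheme.ord_eq_iff hz (algebraMap_ne_zero hirr.ne_zero)]
  exact Ring.ordFrac_irreducible hirr

section Factorial

variable {x : Y} [UniqueFactorizationMonoid (Y.presheaf.stalk x)]

theorem exists_algebraMap_eq_of_ord_nonneg {g : Y.functionField} (hg : g ≠ 0)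
    (h : ∀ z : Y, z ⤳ x → Order.coheight z = 1 → 0 ≤ Scheme.ord g z) :
    ∃ a : Y.presheaf.stalk x, algebraMap _ Y.functionField a = g := by
  obtain ⟨a, b, hab, rfl⟩ := IsFractionRing.exists_reduced_fraction (A := Y.presheaf.stalk x) g
  have hb0 : (b : Y.presheaf.stalk x) ≠ 0 := nonZeroDivisors.ne_zero b.2
  have ha0 : a ≠ 0 := fun e => hg (by rw [e, IsLocalization.mk'_zero])
  by_cases hb : IsUnit (b : Y.presheaf.stalk x)
  · exact ⟨a * hb.unit⁻¹, by
      rw [eq_comm, IsLocalization.mk'_eq_iff_eq_mul, ← map_mul, mul_assoc, hb.val_inv_mul, mul_one]⟩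
  · obtain ⟨π, hπ, hπb⟩ := WfDvdMonoid.exists_irreducible_factor hb hb0
    obtain ⟨z, hzx, hz, hzπ⟩ := exists_coheight_eq_one_of_prime hπ.prime
    have ord_a : Scheme.ord (algebraMap _ Y.functionField a) z = 0 := by
      rw [ord_algebraMap_eq_zero_iff hzx hz ha0, hzπ, Ideal.mem_span_singleton]
      exact fun hπa => hπ.not_isUnit (hab hπa hπb)
    have ord_b_ne : Scheme.ord (algebraMap _ Y.functionField (b : Y.presheaf.stalk x)) z ≠ 0 := by
      rwa [ord_algebraMap_ne_zero_iff hzx hz hb0, hzπ, Ideal.mem_span_singleton]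
    have ord_b_nonneg := ord_algebraMap_nonneg hzx hb0
    have ord_g_nonneg := h z hzx hz
    have ord_mul := Scheme.ord_mul (x := z) hg (algebraMap_ne_zero hb0)
    rw [IsLocalization.mk'_spec, ord_a] at ord_mul
    omega

open Classical in
theorem exists_ord_eq_ite {z : Y} (h : z ⤳ x) (hz : Order.coheight z = 1) :
    ∃ f : Y.functionFieldˣ, ∀ w : Y, w ⤳ x → Order.coheight w = 1 →
      Scheme.ord (f : Y.functionField) w = if w = z then 1 else 0 := by
  obtain ⟨π, hπ, hzπ⟩ := exists_prime_primeAt_eq_span h hz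
  refine ⟨Units.mk0 _ (algebraMap_ne_zero hπ.ne_zero), fun w hw hw1 => ?_⟩
  rw [Units.val_mk0]
  split_ifs with hwz
  · subst hwz
    exact ord_algebraMap_of_primeAt_eq_span hw hw1 hzπ
  · rw [ord_algebraMap_eq_zero_iff hw hw1 hπ.ne_zero, ← Ideal.span_singleton_le_iff_mem, ← hzπ,
      primeAt_le_primeAt_iff]
    exact fun hzw => hwz (eq_of_specializes_of_coheight_eq_one hzw hz hw1).symm

theorem exists_ord_eq (A : Y → ℤ) (hA : {z : Y | Order.coheight z = 1 ∧ A z ≠ 0}.Finite) :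
    ∃ e : Y.functionField, e ≠ 0 ∧
      ∀ z : Y, z ⤳ x → Order.coheight z = 1 → Scheme.ord e z = A z := by
  classical
  choose! f hf using fun z => exists_ord_eq_ite (x := x) (z := z)
  let e : Additive Y.functionFieldˣ := ∑ z ∈ hA.toFinset with z ⤳ x, A z • .ofMul (f z)
  refine ⟨(e.toMul : Y.functionField), e.toMul.ne_zero, fun w hw hw1 => ?_⟩
  calc Scheme.ord (e.toMul : Y.functionField) w
      = ∑ z ∈ hA.toFinset with z ⤳ x, A z • Scheme.ord (f z : Y.functionField) w := by
        rw [← ordUnits_apply, map_sum]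
        exact Finset.sum_congr rfl fun z _ => map_zsmul _ _ _
    _ = ∑ z ∈ hA.toFinset with z ⤳ x, if w = z then A z else 0 := by
        refine Finset.sum_congr rfl fun z hz => ?_
        simp only [Finset.mem_filter, Set.Finite.mem_toFinset, Set.mem_ofPred_eq] at hz
        simp only [hf z hz.2 hz.1.1 w hw hw1, smul_eq_mul, mul_ite, mul_one, mul_zero]
    _ = A w := by
        simp only [Finset.sum_ite_eq, Finset.mem_filter, Set.Finite.mem_toFinset,
          Set.mem_ofPred_eq, hw1, hw, true_and, and_true, ite_not]
        exact ite_eq_right_iff.mpr Eq.symm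

end Factorial

end Order

section Components

open TopologicalSpace

/-- The generic points of the irreducible components of a closed subset `C` of a sober space,
encoded as the points of `C` without proper generizations in `C`. -/
def componentGenericPoints {X : Type*} [TopologicalSpace X] (C : Set X) : Set X :=
  {z | z ∈ C ∧ ∀ w ∈ C, w ⤳ z → w = z}

variable {X : Type*} [TopologicalSpace X] [NoetherianSpace X] [QuasiSober X] {C : Set X}

theorem exists_finset_specializes (hC : IsClosed C) :
    ∃ S : Finset X, (∀ w ∈ S, w ∈ C) ∧ ∀ z ∈ C, ∃ w ∈ S, w ⤳ z := by
  classical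
  obtain ⟨S, hS, hcl, hirr, hCS⟩ := NoetherianSpace.exists_finite_set_isClosed_irreducible hC
  choose w hw using fun t : S => QuasiSober.sober (hirr t t.2) (hcl t t.2)
  have := hS.fintype
  refine ⟨Finset.univ.image w, fun x hx => ?_, fun z hz => ?_⟩
  · obtain ⟨t, -, rfl⟩ := Finset.mem_image.mp hx
    exact hCS ▸ ⟨t, t.2, (hw t).mem⟩
  · obtain ⟨t, ht, hzt⟩ := Set.mem_sUnion.mp (hCS ▸ hz)
    exact ⟨_, Finset.mem_image_of_mem w (Finset.mem_univ ⟨t, ht⟩), (hw ⟨t, ht⟩).specializes hzt⟩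

theorem componentGenericPoints_nonempty [T0Space X] (hC : IsClosed C) (hne : C.Nonempty) :
    (componentGenericPoints C).Nonempty := by
  obtain ⟨S, hSC, hS⟩ := exists_finset_specializes hC
  let := specializationPreorder X
  obtain ⟨x, hx⟩ := hne
  obtain ⟨v, hv⟩ := S.exists_maximal ((hS x hx).imp fun _ => And.left)
  refine ⟨v, hSC v hv.prop, fun w hw hwv => ?_⟩
  obtain ⟨t, htS, htw⟩ := hS w hw
  exact (hwv.antisymm (Specializes.trans (hv.le_of_ge htS (htw.trans hwv)) htw)).eq

theorem finite_componentGenericPoints (hC : IsClosed C) : (componentGenericPoints C).Finite := by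
  obtain ⟨S, hSC, hS⟩ := exists_finset_specializes hC
  refine S.finite_toSet.subset fun z hz => ?_
  obtain ⟨w, hwS, hwz⟩ := hS z hz.1
  exact hz.2 w (hSC w hwS) hwz ▸ hwS

end Components

section Finiteness

variable {Y : Scheme.{u}} [IsIntegral Y] [IsLocallyNoetherian Y] [CompactSpace Y]

theorem finite_setOf_coheight_eq_one_of_isClosed {C : Set Y} (hC : IsClosed C)
    (hη : genericPoint Y ∉ C) : {z : Y | z ∈ C ∧ Order.coheight z = 1}.Finite := by
  have : AlgebraicGeometry.IsNoetherian Y := {}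
  exact (finite_componentGenericPoints hC).subset fun z hz => ⟨hz.1, fun w hw hwz =>
    ((coheight_eq_one_iff.mp hz.2).2 w hwz).resolve_right fun e => hη (e ▸ hw)⟩

theorem finite_setOf_ord_ne_zero (g : Y.functionField) : {z : Y | Scheme.ord g z ≠ 0}.Finite := by
  obtain rfl | hg := eq_or_ne g 0
  · simp
  obtain ⟨U, -, g', hU, rfl, hu⟩ := exists_isUnit_germ_eq Y g hg
  have hηU : genericPoint Y ∉ (U : Set Y)ᶜ := by
    rw [Set.notMem_compl_iff]
    exact ((genericPoint_spec Y).mem_open_set_iff U.isOpen).mpr (by simpa using hU)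
  refine (finite_setOf_coheight_eq_one_of_isClosed U.isOpen.isClosed_compl hηU).subset
    fun z hz => ⟨fun hzU => hz (Scheme.ord_of_isUnit hu hzU), ?_⟩
  by_contra h
  exact hz (Scheme.ord_eq_zero_of_coheight_neq_one h _)

theorem finite_setOf_specializes_of_coheight_le_two {v z : Y} (hv : Order.coheight v = 1)
    (hz : Order.coheight z = 1) (hzv : z ≠ v) :
    {x : Y | v ⤳ x ∧ z ⤳ x ∧ Order.coheight x ≤ 2}.Finite := by
  have : AlgebraicGeometry.IsNoetherian Y := {}
  have hC : IsClosed (closure {v} ∩ closure {z} : Set Y) :=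
    isClosed_closure.inter isClosed_closure
  refine (finite_componentGenericPoints hC).subset fun x ⟨hvx, hzx, hx⟩ =>
    ⟨⟨hvx.mem_closure, hzx.mem_closure⟩, fun w hw hwx => ?_⟩
  have hvw : v ⤳ w := specializes_iff_mem_closure.mpr hw.1
  have hzw : z ⤳ w := specializes_iff_mem_closure.mpr hw.2
  have hvw_ne : v ≠ w := by
    rintro rfl
    exact hzv (eq_of_specializes_of_coheight_eq_one hzw hz hv)
  by_contra hwx_ne
  have hw2 := Order.coheight_add_one_le (lt_of_specializes_of_ne hvw hvw_ne)
  have hx3 := Order.coheight_add_one_le (lt_of_specializes_of_ne hwx hwx_ne)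
  rw [hv] at hw2
  have hchain : (1 + 1 + 1 : ℕ∞) ≤ 2 := (add_le_add_left hw2 1).trans (hx3.trans hx)
  exact absurd hchain (by decide)

end Finiteness

section Sections

variable {Y : Scheme.{u}} [IsIntegral Y]

theorem exists_germ_genericPoint_eq_of_iSup {ι : Type*} (U : ι → Y.Opens) (hU : ⨆ i, U i = ⊤)
    (s : ∀ i, Γ(Y, U i)) (hη : ∀ i, genericPoint Y ∈ U i) (g : Y.functionField)
    (hs : ∀ i, Y.presheaf.germ (U i) (genericPoint Y) (hη i) (s i) = g) :
    ∃ t : Γ(Y, ⊤), Y.presheaf.germ ⊤ (genericPoint Y) trivial t = g := by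
  have hcompat : TopCat.Presheaf.IsCompatible Y.presheaf U s := by
    intro i j
    refine germ_injective_of_isIntegral Y (genericPoint Y) (U := U i ⊓ U j) ⟨hη i, hη j⟩ ?_
    calc _ = Y.presheaf.germ (U i) (genericPoint Y) (hη i) (s i) :=
          Y.presheaf.germ_res_apply (TopologicalSpace.Opens.infLELeft (U i) (U j)) _ _ _
      _ = Y.presheaf.germ (U j) (genericPoint Y) (hη j) (s j) := (hs i).trans (hs j).symm
      _ = _ := (Y.presheaf.germ_res_apply
          (TopologicalSpace.Opens.infLERight (U i) (U j)) _ _ _).symm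
  obtain ⟨t, ht, -⟩ := Y.sheaf.existsUnique_gluing' U ⊤ (fun _ => homOfLE le_top) hU.ge s hcompat
  obtain ⟨i, -⟩ := TopologicalSpace.Opens.mem_iSup.mp (hU ▸ trivial : genericPoint Y ∈ ⨆ i, U i)
  refine ⟨t, ?_⟩
  rw [← hs i, ← ht i]
  exact (Y.presheaf.germ_res_apply (homOfLE le_top) _ _ _).symm

theorem exists_germ_genericPoint_eq (g : Y.functionField)
    (h : ∀ x : Y, ∃ a : Y.presheaf.stalk x, algebraMap _ Y.functionField a = g) :
    ∃ t : Γ(Y, ⊤), Y.presheaf.germ ⊤ (genericPoint Y) trivial t = g := by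
  have hloc : ∀ x : Y, ∃ (U : Y.Opens) (_ : x ∈ U) (hη : genericPoint Y ∈ U) (s : Γ(Y, U)),
      Y.presheaf.germ U (genericPoint Y) hη s = g := by
    intro x
    obtain ⟨a, ha⟩ := h x
    obtain ⟨U, hxU, s, rfl⟩ := Y.presheaf.exists_germ_eq a
    have : Nonempty U := ⟨⟨x, hxU⟩⟩
    rw [Scheme.algebraMap_germ_eq_germToFunctionField] at ha
    exact ⟨U, hxU, (genericPoint_specializes x).mem_open U.isOpen hxU, s, ha⟩
  choose U hxU hη s hs using hloc
  exact exists_germ_genericPoint_eq_of_iSup U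
    (eq_top_iff.mpr fun x _ => TopologicalSpace.Opens.mem_iSup.mpr ⟨x, hxU x⟩) s hη g hs

variable [IsLocallyNoetherian Y] [IsRegularScheme Y]

section Factorial

variable {x : Y} [UniqueFactorizationMonoid (Y.presheaf.stalk x)] (A : Y → ℤ)
  (hA : {z : Y | Order.coheight z = 1 ∧ A z ≠ 0}.Finite)

include hA

theorem exists_stalkO_eq_span :
    ∃ e : Y.functionField, e ≠ 0 ∧ stalkO A x = Submodule.span (Y.presheaf.stalk x) {e} ∧
      ∀ z : Y, z ⤳ x → Order.coheight z = 1 → Scheme.ord e z = - A z := by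
  obtain ⟨e, he0, he⟩ :=
    exists_ord_eq (x := x) (fun z => - A z) (by simpa only [ne_eq, neg_eq_zero])
  refine ⟨e, he0, le_antisymm (fun g hg => ?_) ?_, he⟩
  · obtain rfl | hg0 := eq_or_ne g 0
    · exact zero_mem _
    obtain ⟨a, ha⟩ := exists_algebraMap_eq_of_ord_nonneg (x := x)
      (mul_ne_zero hg0 (inv_ne_zero he0)) fun z hz hz1 => by
        rw [Scheme.ord_mul hg0 (inv_ne_zero he0), ord_inv he0, he z hz hz1, neg_neg]
        exact hg hg0 z hz hz1
    refine Submodule.mem_span_singleton.mpr ⟨a, ?_⟩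
    rw [Algebra.smul_def, ha, inv_mul_cancel_right₀ he0]
  · rw [Submodule.span_singleton_le_iff_mem]
    intro _ z hz hz1
    rw [he z hz hz1, neg_add_cancel]

theorem exists_hasOrderAt {v : Y} (h : v ⤳ x) (hv : Order.coheight v = 1) {g : Y.functionField}
    (hg0 : g ≠ 0) (hg : g ∈ stalkO A x) (hgv : Scheme.ord g v + A v = 0) :
    ∃ n : ℤ, 0 ≤ n ∧ HasOrderAt A h g n ∧
      (n ≠ 0 → ∃ z : Y, z ⤳ x ∧ Order.coheight z = 1 ∧ Scheme.ord g z + A z ≠ 0) := by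
  obtain ⟨e, he0, hspan, he⟩ := exists_stalkO_eq_span (x := x) A hA
  obtain ⟨a, rfl⟩ := Submodule.mem_span_singleton.mp (hspan ▸ hg)
  have ha0 : a ≠ 0 := fun ha => hg0 (by rw [ha, zero_smul])
  have hord {z : Y} (hz : z ⤳ x) (hz1 : Order.coheight z = 1) :
      Scheme.ord (a • e) z + A z = Scheme.ord (algebraMap _ Y.functionField a) z := by
    rw [ord_smul ha0 he0, he z hz hz1, neg_add_cancel_right]
  have hav : a ∉ primeAt h := by
    rw [← ord_algebraMap_eq_zero_iff h hv ha0, ← hord h hv, hgv]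
  refine ⟨((Ring.ord (Y.presheaf.stalk x ⧸ primeAt h) (Ideal.Quotient.mk _ a)).toNat : ℤ),
    Int.natCast_nonneg _, ⟨e, hspan, a, 1, hav, ?_, one_smul _ _, ?_⟩, fun hn => ?_⟩
  · exact (Ideal.ne_top_iff_one _).mp (primeAt_isPrime h).ne_top
  · rw [map_one, Ring.ord_one, ENat.toNat_zero, Nat.cast_zero, sub_zero]
  · have hau : ¬ IsUnit a := fun hu => hn (by
      rw [Ring.ord_of_isUnit (hu.map (Ideal.Quotient.mk (primeAt h))), ENat.toNat_zero,
        Nat.cast_zero])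
    obtain ⟨π, hπ, hπa⟩ := WfDvdMonoid.exists_irreducible_factor hau ha0
    obtain ⟨z, hzx, hz1, hzπ⟩ := exists_coheight_eq_one_of_prime hπ.prime
    refine ⟨z, hzx, hz1, ?_⟩
    rwa [hord hzx hz1, ord_algebraMap_ne_zero_iff hzx hz1 ha0, hzπ, Ideal.mem_span_singleton]

end Factorial

theorem mem_stalkO_sub_one_of_mem_smul_top {A : Y → ℤ} {v : Y} (hv : Order.coheight v = 1)
    {y : stalkO A v} (hy : y ∈ IsLocalRing.maximalIdeal (Y.presheaf.stalk v) •
      (⊤ : Submodule (Y.presheaf.stalk v) (stalkO A v))) :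
    (y : Y.functionField) ∈ stalkO (A - 1) v := by
  refine Submodule.smul_induction_on hy (fun a ha n _ hne z hzv hz => ?_)
    fun _ _ hy hy' => add_mem hy hy'
  obtain rfl := eq_of_specializes_of_coheight_eq_one hzv hz hv
  have ha0 : a ≠ 0 := fun e => hne (by rw [e, zero_smul, Submodule.coe_zero])
  have hn0 : (n : Y.functionField) ≠ 0 := fun e => hne (by rw [Submodule.coe_smul, e, smul_zero])
  have ord_n := n.2 hn0 z specializes_rfl hz
  have ord_a_nonneg := ord_algebraMap_nonneg specializes_rfl (z := z) ha0
  have ord_a_ne : Scheme.ord (algebraMap _ Y.functionField a) z ≠ 0 := by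
    rwa [ord_algebraMap_ne_zero_iff specializes_rfl hz ha0, primeAt_refl]
  rw [Submodule.coe_smul, ord_smul ha0 hn0, Pi.sub_apply, Pi.one_apply]
  omega

theorem stalkRestrict_mk_ne_zero {A : Y → ℤ} {v : Y} (hv : Order.coheight v = 1)
    {g : Y.functionField} (hg0 : g ≠ 0) (hg : g ∈ stalkO A v) (hgv : Scheme.ord g v + A v = 0) :
    (Submodule.Quotient.mk ⟨g, hg⟩ : StalkRestrict A (specializes_rfl : v ⤳ v)) ≠ 0 := by
  intro h
  rw [Submodule.Quotient.mk_eq_zero, primeAt_refl] at h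
  have hnonneg : 0 ≤ Scheme.ord g v + (A v - 1) :=
    mem_stalkO_sub_one_of_mem_smul_top hv h hg0 v specializes_rfl hv
  omega

end Sections

section OpenImmersion

variable {U Y : Scheme.{u}} [IsIntegral U] [IsIntegral Y] (i : U ⟶ Y) [IsOpenImmersion i]

/-- The isomorphism of function fields induced by an open immersion. -/
noncomputable def functionFieldEquiv : Y.functionField ≃+* U.functionField :=
  (Y.presheaf.stalkCongr (.of_eq (genericPoint_eq_of_isOpenImmersion i).symm) ≪≫
    asIso (i.stalkMap (genericPoint U))).commRingCatIsoToRingEquiv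

theorem functionFieldEquiv_algebraMap (y : U) (a : Y.presheaf.stalk (i y)) :
    functionFieldEquiv i (algebraMap _ Y.functionField a) =
      algebraMap _ U.functionField ((i.stalkMap y).hom a) := by
  refine Eq.trans (congrArg (i.stalkMap (genericPoint U)).hom ?_)
    (Scheme.Hom.stalkSpecializes_stalkMap_apply i _ _ (genericPoint_specializes y) a)
  exact stalkSpecializes_trans_apply
    (specializes_of_eq (genericPoint_eq_of_isOpenImmersion i)) (genericPoint_specializes (i y)) a

variable [IsLocallyNoetherian U] [IsLocallyNoetherian Y] [IsRegularScheme U] [IsRegularScheme Y]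

theorem ord_functionFieldEquiv (g : Y.functionField) (y : U) :
    Scheme.ord (functionFieldEquiv i g) y = Scheme.ord g (i y) := by
  have hco : Order.coheight (i y) = Order.coheight y := coheight_eq_of_isOpenImmersion i
  by_cases hy : Order.coheight y = 1
  · obtain rfl | hg := eq_or_ne g 0
    · simp
    have := isDiscreteValuationRing_stalk y hy
    have := isDiscreteValuationRing_stalk (i y) (hco.trans hy)
    rw [Scheme.ord_eq_iff hy (by simpa using hg), ← (Scheme.ord_eq_iff (hco.trans hy) hg).mp rfl]
    exact ordFrac_ringEquiv (asIso (i.stalkMap y)).commRingCatIsoToRingEquiv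
      (functionFieldEquiv i : Y.functionField →+* U.functionField)
      (functionFieldEquiv_algebraMap i y) g
  · rw [Scheme.ord_eq_zero_of_coheight_neq_one hy,
      Scheme.ord_eq_zero_of_coheight_neq_one (hco.trans_ne hy)]

end OpenImmersion

section Dimension

variable {X Y : Scheme.{u}}

theorem eq_of_specializes_of_isIntegralHom (p : X ⟶ Y) [IsIntegralHom p] {w y : X} (h : w ⤳ y)
    (hp : p w = p y) : w = y := by
  obtain ⟨_, ⟨U, hU, rfl⟩, hyU, -⟩ :=
    Y.isBasis_affineOpens.exists_subset_of_mem_open (Set.mem_univ (p y)) isOpen_univ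
  have hV : IsAffineOpen (p ⁻¹ᵁ U) := hU.preimage p
  have hwU : w ∈ p ⁻¹ᵁ U := h.mem_open (p ⁻¹ᵁ U).isOpen hyU
  let q := hV.primeIdealOf ⟨w, hwU⟩
  let q' := hV.primeIdealOf ⟨y, hyU⟩
  have hle : q ≤ q' := (PrimeSpectrum.le_iff_specializes _ _).mpr
    (hV.fromSpec.isEmbedding.isInducing.specializes_iff.mp (by
      rwa [hV.fromSpec_primeIdealOf, hV.fromSpec_primeIdealOf]))
  have hcomap : q.comap (p.app U).hom = q'.comap (p.app U).hom := by
    rw [← Scheme.Hom.appLE_eq_app, IsAffineOpen.comap_primeIdealOf_appLE U hU _ hV le_rfl hwU,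
      IsAffineOpen.comap_primeIdealOf_appLE U hU _ hV le_rfl hyU]
    exact congrArg hU.primeIdealOf (Subtype.ext hp)
  have heq : q = q' := by
    by_contra hne
    algebraize [(p.app U).hom]
    have : Algebra.IsIntegral Γ(Y, U) Γ(X, p ⁻¹ᵁ U) := ⟨p.isIntegral_app U hU⟩
    have hlt : q.asIdeal < q'.asIdeal := lt_of_le_of_ne hle fun e => hne (PrimeSpectrum.ext e)
    exact (Ideal.IsIntegral.comap_lt_comap (R := Γ(Y, U)) hlt).ne
      (congrArg PrimeSpectrum.asIdeal hcomap)
  simpa only [hV.fromSpec_primeIdealOf, q, q'] using congrArg hV.fromSpec heq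

theorem strictMono_of_isIntegralHom (p : X ⟶ Y) [IsIntegralHom p] : StrictMono p := fun y w h =>
  lt_of_specializes_of_ne (Specializes.map (show w ⤳ y from h.le) p.continuous) fun e =>
    h.ne (eq_of_specializes_of_isIntegralHom p (show w ⤳ y from h.le) e).symm

theorem coheight_of_flat_of_isIntegralHom (p : X ⟶ Y) [IsIntegralHom p] [Flat p] (x : X) :
    Order.coheight (p x) = Order.coheight x := by
  refine (Order.coheight_eq_of_strictMono p (strictMono_of_isIntegralHom p) (fun a b hab => ?_)
    x).symm
  obtain ⟨a', ha', rfl⟩ := Flat.generalizingMap p (show b ⤳ p a from hab.le)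
  exact ⟨a', lt_of_specializes_of_ne ha' (by rintro rfl; exact hab.false), rfl⟩

theorem isClosed_singleton_of_isIntegralHom (p : X ⟶ Y) [IsIntegralHom p] {x : X}
    (hx : IsClosed ({p x} : Set Y)) : IsClosed ({x} : Set X) := by
  refine isClosed_of_closure_subset fun x' hx' => ?_
  have h : x ⤳ x' := specializes_iff_mem_closure.mpr hx'
  exact (eq_of_specializes_of_isIntegralHom p h
    ((h.map p.continuous).mem_closed hx (Set.mem_singleton _)).symm).symm

theorem IsSemistable.coheight_eq_one {S : Scheme.{u}} {f : X ⟶ S} (hf : IsSemistable f)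
    (k : Type u) [Field k] (s : Spec (.of k) ⟶ S) {y : (pullback f s : Scheme.{u})}
    (hy : IsClosed ({y} : Set (pullback f s : Scheme.{u}))) : Order.coheight y = 1 := by
  let t : Spec (.of (AlgebraicClosure k)) ⟶ Spec (.of k) :=
    Spec.map (CommRingCat.ofHom (algebraMap k (AlgebraicClosure k)))
  have : IsIntegralHom t :=
    IsIntegralHom.SpecMap_iff.mpr (algebraMap_isIntegral_iff.mpr inferInstance)
  have : Flat t := Flat.SpecMap_iff.mpr
    ((RingHom.flat_algebraMap_iff (R := k) (S := AlgebraicClosure k)).mpr inferInstance)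
  have : Surjective t := ⟨fun z => ⟨IsLocalRing.closedPoint (AlgebraicClosure k),
    (PrimeSpectrum.instUnique (R := k)).instSubsingleton.elim _ _⟩⟩
  let p := pullback.fst (pullback.snd f s) t
  obtain ⟨x, rfl⟩ := p.surjective y
  let e := pullbackLeftPullbackSndIso f s t
  have hex : IsClosed ({e.hom x} : Set ↑(pullback f (t ≫ s))) := by
    rw [← Set.image_singleton]
    exact e.hom.homeomorph.isClosedMap _ (isClosed_singleton_of_isIntegralHom p hy)
  have hdim := (hf.nodal (AlgebraicClosure k) (t ≫ s) (e.hom x) hex).1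
  have hcoheight : Order.coheight (e.hom x) = Order.coheight x :=
    coheight_eq_of_isOpenImmersion e.hom
  rw [ringKrullDim_stalk_eq_coheight, hcoheight, ← coheight_of_flat_of_isIntegralHom p] at hdim
  exact_mod_cast hdim

theorem ringKrullDim_stalk_quotient_le_coheight (i : X ⟶ Y) [IsPreimmersion i] (x : X)
    (I : Ideal (Y.presheaf.stalk (i x)))
    (hI : ∀ (z : Y) (h : z ⤳ i x), I ≤ primeAt h → z ∈ Set.range i) :
    ringKrullDim (Y.presheaf.stalk (i x) ⧸ I) ≤ Order.coheight x := by
  have hle (q : PrimeSpectrum (Y.presheaf.stalk (i x) ⧸ I)) :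
      I ≤ q.asIdeal.comap (Ideal.Quotient.mk I) := by
    rw [← Ideal.map_le_iff_le_comap, Ideal.map_quotient_self]
    exact bot_le
  have hlift (q : PrimeSpectrum (Y.presheaf.stalk (i x) ⧸ I)) : ∃ (z : X) (h : i z ⤳ i x),
      primeAt h = q.asIdeal.comap (Ideal.Quotient.mk I) := by
    obtain ⟨z, h, hz⟩ := exists_primeAt_eq (q.asIdeal.comap (Ideal.Quotient.mk I))
    obtain ⟨z, rfl⟩ := hI z h (hz ▸ hle q)
    exact ⟨z, h, hz⟩
  choose z hz hq using hlift
  have hzx (q) : z q ⤳ x := i.isEmbedding.isInducing.specializes_iff.mp (hz q)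
  have hmono : StrictMono fun q => OrderDual.toDual (⟨z q, hzx q⟩ : Set.Ici x) := by
    refine fun q q' hqq' => lt_of_specializes_of_ne (w := z q) (z := z q') ?_ fun e => ?_
    · rw [← i.isEmbedding.isInducing.specializes_iff, ← primeAt_le_primeAt_iff (hz q) (hz q'),
        hq, hq]
      exact Ideal.comap_mono hqq'.le
    · refine hqq'.ne (PrimeSpectrum.ext
        (Ideal.comap_injective_of_surjective _ Ideal.Quotient.mk_surjective ?_))
      rw [← hq, ← hq, primeAt_inj, e]
  rw [Order.coheight_eq_krullDim_Ici, ← Order.krullDim_orderDual]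
  exact Order.krullDim_le_of_strictMono _ hmono

theorem coheight_le_coheight_add_one [IsLocallyNoetherian Y] (i : X ⟶ Y) [IsPreimmersion i]
    (x : X) (a : Y.presheaf.stalk (i x))
    (ha : ∀ (z : Y) (h : z ⤳ i x), a ∈ primeAt h ↔ z ∈ Set.range i) :
    Order.coheight (i x) ≤ Order.coheight x + 1 := by
  have hax : a ∈ IsLocalRing.maximalIdeal (Y.presheaf.stalk (i x)) := by
    rw [← primeAt_refl]
    exact (ha _ _).mpr ⟨x, rfl⟩
  have hkrull := Ideal.height_le_ringKrullDim_quotient_add_one hax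
  have hquot := ringKrullDim_stalk_quotient_le_coheight i x (Ideal.span {a}) fun z h hz =>
    (ha z h).mp ((Ideal.span_singleton_le_iff_mem _).mp hz)
  rw [IsLocalRing.maximalIdeal_height_eq_ringKrullDim, ringKrullDim_stalk_eq_coheight] at hkrull
  exact_mod_cast hkrull.trans (add_le_add_left hquot 1)

end Dimension

section LocalEquation

variable {R : Type u} [CommRing R] {X : Scheme.{u}} (f : X ⟶ Spec (.of R))

/-- The image of an element of the base ring in the local ring at a point. -/
noncomputable def stalkScalar (r : R) (z : X) : X.presheaf.stalk z :=
  X.presheaf.germ ⊤ z trivial (f.appTop ((Scheme.ΓSpecIso (.of R)).inv r))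

theorem isUnit_stalkScalar_iff (r : R) (z : X) :
    IsUnit (stalkScalar f r z) ↔ r ∉ (f z).asIdeal := by
  rw [stalkScalar, ← Scheme.mem_basicOpen_top, ← Scheme.preimage_basicOpen_top]
  change f z ∈ (Spec (.of R)).basicOpen ((Scheme.ΓSpecIso (.of R)).inv r) ↔ _
  rw [basicOpen_eq_of_affine]
  rfl

theorem stalkSpecializes_stalkScalar (r : R) {w z : X} (h : w ⤳ z) :
    (X.presheaf.stalkSpecializes h).hom (stalkScalar f r z) = stalkScalar f r w := by
  rw [stalkScalar, stalkScalar,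
    ← X.presheaf.germ_stalkSpecializes (TopologicalSpace.Opens.mem_top z) h]
  rfl

theorem stalkScalar_mem_primeAt_iff (r : R) {w z : X} (h : w ⤳ z) :
    stalkScalar f r z ∈ primeAt h ↔ r ∈ (f w).asIdeal := by
  rw [mem_primeAt_iff, stalkSpecializes_stalkScalar, isUnit_stalkScalar_iff, not_not]

end LocalEquation

namespace RegularSemistableModel

variable {R K : Type u} [CommRing R] [IsDomain R] [IsDiscreteValuationRing R] [Field K]
  [Algebra R K] [IsFractionRing R K] {M : RegularSemistableModel R K}

section SpecialFibre

variable (M)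

instance : IsProper M.f := M.isProper

instance : CompactSpace M.X := (quasiCompact_iff_compactSpace M.f).mp inferInstance

instance : AlgebraicGeometry.IsNoetherian M.X where

instance : IsProper M.toSpecK :=
  inferInstanceAs (IsProper (pullback.snd M.f (Spec.map (CommRingCat.ofHom (algebraMap R K)))))

instance : CompactSpace M.genericFibre :=
  (quasiCompact_iff_compactSpace M.toSpecK).mp inferInstance

theorem range_ι : Set.range M.ι = {z | M.f z ≠ IsLocalRing.closedPoint R} := by
  obtain ⟨ϖ, hϖ⟩ := IsDiscreteValuationRing.exists_irreducible R
  have := isLocalization_away_of_irreducible R K ϖ hϖ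
  have hfst : Set.range M.ι =
      M.f ⁻¹' Set.range (Spec.map (CommRingCat.ofHom (algebraMap R K))) :=
    Scheme.Pullback.range_fst _ _
  have haway : Set.range (Spec.map (CommRingCat.ofHom (algebraMap R K))) =
      (PrimeSpectrum.basicOpen ϖ : Set (PrimeSpectrum R)) :=
    PrimeSpectrum.localization_away_comap_range K ϖ
  rw [hfst, haway]
  ext z
  exact (mem_asIdeal_iff_eq_closedPoint hϖ (M.f z)).not

theorem f_ι_ne (y : M.genericFibre) : M.f (M.ι y) ≠ IsLocalRing.closedPoint R :=
  M.range_ι.subset ⟨y, rfl⟩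

theorem f_genericPoint_ne : M.f (genericPoint M.X) ≠ IsLocalRing.closedPoint R := by
  rw [← genericPoint_eq_of_isOpenImmersion M.ι]
  exact M.f_ι_ne _

theorem isClosed_specialFibre : IsClosed {z : M.X | M.f z = IsLocalRing.closedPoint R} :=
  IsClosed.preimage M.f.continuous (IsLocalRing.isClosed_singleton_closedPoint R)

theorem f_eq_closedPoint_of_specializes {v x : M.X} (h : v ⤳ x)
    (hv : M.f v = IsLocalRing.closedPoint R) : M.f x = IsLocalRing.closedPoint R :=
  h.mem_closed M.isClosed_specialFibre hv

theorem exists_f_eq_closedPoint : ∃ x : M.X, M.f x = IsLocalRing.closedPoint R :=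
  (IsLocalRing.specializes_closedPoint (M.f (genericPoint M.X))).mem_closed
    M.f.isClosedMap.isClosed_range ⟨_, rfl⟩

/-- The special fibre. -/
noncomputable def specialFibre : Scheme.{u} :=
  pullback M.f (Spec.map (CommRingCat.ofHom (IsLocalRing.residue R)))

/-- The inclusion of the special fibre into the model. -/
noncomputable def specialFibreι : M.specialFibre ⟶ M.X := pullback.fst _ _

instance : IsClosedImmersion M.specialFibreι := by
  have : IsClosedImmersion (Spec.map (CommRingCat.ofHom (IsLocalRing.residue R))) :=
    IsClosedImmersion.spec_of_surjective _ IsLocalRing.residue_surjective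
  exact inferInstanceAs (IsClosedImmersion (pullback.fst M.f _))

theorem range_specialFibreι :
    Set.range M.specialFibreι = {z | M.f z = IsLocalRing.closedPoint R} := by
  have hfst : Set.range M.specialFibreι =
      M.f ⁻¹' Set.range (Spec.map (CommRingCat.ofHom (IsLocalRing.residue R))) :=
    Scheme.Pullback.range_fst _ _
  have hpoint : Set.range (Spec.map (CommRingCat.ofHom (IsLocalRing.residue R))) =
      {IsLocalRing.closedPoint R} := by
    refine Set.eq_singleton_iff_unique_mem.mpr
      ⟨⟨IsLocalRing.closedPoint _, IsLocalRing.comap_closedPoint (IsLocalRing.residue R)⟩, ?_⟩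
    rintro _ ⟨p, rfl⟩
    exact IsLocalRing.PrimeSpectrum.comap_residue R p
  rw [hfst, hpoint]
  rfl

theorem coheight_specialFibreι_le (y : M.specialFibre) :
    Order.coheight (M.specialFibreι y) ≤ Order.coheight y + 1 := by
  obtain ⟨ϖ, hϖ⟩ := IsDiscreteValuationRing.exists_irreducible R
  refine coheight_le_coheight_add_one M.specialFibreι y (stalkScalar M.f ϖ _) fun z h => ?_
  rw [stalkScalar_mem_primeAt_iff, range_specialFibreι]
  exact mem_asIdeal_iff_eq_closedPoint hϖ (M.f z)

theorem IsComponent.coheight_eq_one {v : M.X} (hv : M.IsComponent v) : Order.coheight v = 1 := by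
  obtain ⟨y, rfl⟩ := M.range_specialFibreι.superset hv.1
  have hy : Order.coheight y = 0 := Order.coheight_eq_zero.mpr fun w (hw : w ⤳ y) =>
    specializes_of_eq (M.specialFibreι.isEmbedding.injective
      (hv.2 _ (M.range_specialFibreι.subset ⟨w, rfl⟩) (hw.map M.specialFibreι.continuous))).symm
  refine le_antisymm ((M.coheight_specialFibreι_le y).trans_eq (by rw [hy, zero_add]))
    (Order.one_le_iff_ne_zero.mpr fun h => M.f_genericPoint_ne ?_)
  rw [← coheight_eq_zero_iff.mp h]
  exact hv.1

theorem isComponent_of_coheight_eq_one {z : M.X} (hz : Order.coheight z = 1)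
    (hf : M.f z = IsLocalRing.closedPoint R) : M.IsComponent z :=
  ⟨hf, fun w hw hwz => ((coheight_eq_one_iff.mp hz).2 w hwz).resolve_right fun e =>
    M.f_genericPoint_ne (e ▸ hw)⟩

theorem finite_setOf_isComponent : {v : M.X | M.IsComponent v}.Finite :=
  finite_componentGenericPoints M.isClosed_specialFibre

theorem exists_isComponent : ∃ v : M.X, M.IsComponent v :=
  componentGenericPoints_nonempty M.isClosed_specialFibre M.exists_f_eq_closedPoint

theorem coheight_le_two_of_isClosed {x : M.X} (hx : IsClosed ({x} : Set M.X))
    (hf : M.f x = IsLocalRing.closedPoint R) : Order.coheight x ≤ 2 := by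
  obtain ⟨y, rfl⟩ := M.range_specialFibreι.superset hf
  have hy : IsClosed ({y} : Set M.specialFibre) := by
    rwa [M.specialFibreι.isClosedEmbedding.isClosed_iff_image_isClosed, Set.image_singleton]
  have hy1 : Order.coheight y = 1 := M.isSemistable.coheight_eq_one (IsLocalRing.ResidueField R)
    (Spec.map (CommRingCat.ofHom (IsLocalRing.residue R))) hy
  exact (M.coheight_specialFibreι_le y).trans_eq (by rw [hy1, one_add_one_eq_two])

theorem coheight_genericFibre_eq_one_of_isClosed {y : M.genericFibre}
    (hy : IsClosed ({y} : Set M.genericFibre)) : Order.coheight y = 1 :=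
  M.isSemistable.coheight_eq_one K (Spec.map (CommRingCat.ofHom (algebraMap R K))) hy

end SpecialFibre

section Divisors

open Classical in
theorem closure_ι (D : M.Div) (y : M.genericFibre) : closure D (M.ι y) = genericDivisor D y :=
  Finset.sum_congr rfl fun _ _ => if_congr M.ι.isOpenEmbedding.injective.eq_iff rfl rfl

theorem exists_of_closure_ne_zero {D : M.Div} {z : M.X} (h : closure D z ≠ 0) :
    ∃ P ∈ D.support, M.ι P.pt = z := by
  by_contra! hc
  exact h (Finset.sum_eq_zero fun P hP => if_neg (hc P hP))

theorem closure_eq_zero (D : M.Div) {z : M.X} (hz : M.f z = IsLocalRing.closedPoint R) :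
    closure D z = 0 := by
  by_contra h
  obtain ⟨P, -, rfl⟩ := exists_of_closure_ne_zero h
  exact M.f_ι_ne _ hz

theorem twist_eq_zero (φ : M.Component → ℤ) {z : M.X} (hz : ¬ M.IsComponent z) : twist φ z = 0 :=
  dif_neg hz

theorem twist_ι (φ : M.Component → ℤ) (y : M.genericFibre) : twist φ (M.ι y) = 0 :=
  twist_eq_zero φ fun h => M.f_ι_ne y h.1

theorem twist_component (φ : M.Component → ℤ) (v : M.Component) : twist φ v.1 = φ v :=
  dif_pos v.2

theorem finite_setOf_closure_add_twist_ne_zero (D : M.Div) (φ : M.Component → ℤ) :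
    {z : M.X | (closure D + twist φ) z ≠ 0}.Finite := by
  refine ((D.support.finite_toSet.image fun P => M.ι P.pt).union
    M.finite_setOf_isComponent).subset fun z hz => ?_
  by_cases hDz : closure D z = 0
  · refine Or.inr (of_not_not fun hc => hz ?_)
    rw [Pi.add_apply, hDz, twist_eq_zero φ hc, add_zero]
  · obtain ⟨P, hP, hPz⟩ := exists_of_closure_ne_zero hDz
    exact Or.inl ⟨P, hP, hPz⟩

end Divisors

section Degrees

variable {A : M.X → ℤ} {g : M.X.functionField}

theorem Component.coheight_le_two (v : M.Component) {x : M.X} (hvx : v.1 ⤳ x)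
    (hx : IsClosed ({x} : Set M.X)) : Order.coheight x ≤ 2 :=
  M.coheight_le_two_of_isClosed hx (M.f_eq_closedPoint_of_specializes hvx v.2.1)

theorem finite_setOf_isClosed_of_ord_add_ne_zero (hA : {z : M.X | A z ≠ 0}.Finite)
    (v : M.Component) (hgv : Scheme.ord g v.1 + A v.1 = 0) :
    {x : M.X | (v.1 ⤳ x ∧ IsClosed ({x} : Set M.X)) ∧
      ∃ z : M.X, z ⤳ x ∧ Order.coheight z = 1 ∧ Scheme.ord g z + A z ≠ 0}.Finite := by
  have hT : {z : M.X | Order.coheight z = 1 ∧ Scheme.ord g z + A z ≠ 0}.Finite := by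
    refine ((finite_setOf_ord_ne_zero g).union hA).subset fun z hz => ?_
    by_contra! hc
    simp only [Set.mem_union, Set.mem_ofPred_eq, not_or, not_not] at hc
    exact hz.2 (by rw [hc.1, hc.2, add_zero])
  refine (hT.biUnion fun z ⟨hz1, hz⟩ => finite_setOf_specializes_of_coheight_le_two
    v.2.coheight_eq_one hz1 fun e => hz (e ▸ hgv)).subset ?_
  rintro x ⟨⟨hvx, hx⟩, z, hzx, hz⟩
  exact Set.mem_biUnion (show z ∈ _ from hz) ⟨hvx, hzx, v.coheight_le_two hvx hx⟩

theorem nonnegDegrees_of_ord_add_eq_zero (hA : {z : M.X | A z ≠ 0}.Finite) (hg0 : g ≠ 0)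
    (hg : ∀ x, g ∈ stalkO A x) (hgv : ∀ v : M.Component, Scheme.ord g v.1 + A v.1 = 0) :
    NonnegDegrees A := by
  intro v
  have hord (x : {x : M.X // v.1 ⤳ x ∧ IsClosed ({x} : Set M.X)}) : ∃ n : ℤ, 0 ≤ n ∧
      HasOrderAt A x.2.1 g n ∧
      (n ≠ 0 → ∃ z : M.X, z ⤳ x.1 ∧ Order.coheight z = 1 ∧ Scheme.ord g z + A z ≠ 0) := by
    have := uniqueFactorizationMonoid_stalk (v.coheight_le_two x.2.1 x.2.2)
    exact exists_hasOrderAt A (hA.subset fun z hz => hz.2) x.2.1 v.2.coheight_eq_one hg0 (hg x.1)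
      (hgv v)
  choose n hn0 hn hn_ne using hord
  have hfin : (Function.support n).Finite :=
    ((finite_setOf_isClosed_of_ord_add_ne_zero hA v (hgv v)).preimage
      Subtype.val_injective.injOn).subset fun x hx => ⟨x.2, hn_ne x hx⟩
  exact ⟨_, Finset.sum_nonneg fun x _ => mul_nonneg (hn0 x) (Int.natCast_nonneg _), g,
    Finsupp.ofSupportFinite n hfin, hn, rfl⟩

end Degrees

section RestrictSections

variable {A : M.X → ℤ} {g : M.X.functionField}

theorem toFibre_mk {v x : M.X} (h : v ⤳ x) (g : stalkO A x) :
    toFibre A h (Submodule.Quotient.mk g) = Submodule.Quotient.mk g :=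
  Submodule.factor_mk (Submodule.smul_mono_left (primeAt_le h)) g

/-- The restrictions of a global section of `𝒪(A)` to the components of the special fibre. -/
noncomputable def restrictSections (hg : ∀ x, g ∈ stalkO A x) : SectionFamily A := fun _ =>
  { val := fun x _ => Submodule.Quotient.mk ⟨g, hg x⟩
    isLocal := fun _ _ => ⟨⊤, trivial, g, fun y _ => ⟨hg y, fun _ => rfl⟩⟩ }

theorem restrictSections_agreeAtNodes (hg : ∀ x, g ∈ stalkO A x) :
    (restrictSections hg).AgreeAtNodes :=
  fun _ _ _ hv hw => (toFibre_mk hv _).trans (toFibre_mk hw _).symm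

theorem restrictSections_extends (hg : ∀ x, g ∈ stalkO A x) : (restrictSections hg).Extends :=
  ⟨g, hg, fun _ _ _ => rfl⟩

theorem restrictSections_nonzero (hg : ∀ x, g ∈ stalkO A x) (hg0 : g ≠ 0)
    (hgv : ∀ v : M.Component, Scheme.ord g v.1 + A v.1 = 0) : (restrictSections hg).Nonzero :=
  fun v => ⟨v.1, specializes_rfl,
    stalkRestrict_mk_ne_zero v.2.coheight_eq_one hg0 (hg v.1) (hgv v)⟩

theorem SectionFamily.Extends.exists_ne_zero {s : SectionFamily A} (hs : s.Nonzero)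
    (he : s.Extends) : ∃ g : M.X.functionField, g ≠ 0 ∧ ∀ x, g ∈ stalkO A x := by
  obtain ⟨g, hg, hgs⟩ := he
  obtain ⟨v, hv⟩ := M.exists_isComponent
  obtain ⟨x, hx, hne⟩ := hs ⟨v, hv⟩
  refine ⟨g, ?_, hg⟩
  rintro rfl
  exact hne ((hgs _ _ _).trans (Submodule.Quotient.mk_zero _))

end RestrictSections

section SatisfiesX

variable {D : M.Div}

theorem mem_H0_iff {g : M.genericFibre.functionField} (hg0 : g ≠ 0) : g ∈ H0 D ↔
    ∀ z : M.genericFibre, Order.coheight z = 1 → 0 ≤ Scheme.ord g z + genericDivisor D z :=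
  ⟨fun hg z hz => hg z hg0 z specializes_rfl hz, fun h _ _ z _ hz => h z hz⟩

theorem functionFieldEquiv_mem_H0_iff {g : M.X.functionField} (hg0 : g ≠ 0) :
    functionFieldEquiv M.ι g ∈ H0 D ↔ ∀ y : M.genericFibre, Order.coheight (M.ι y) = 1 →
      0 ≤ Scheme.ord g (M.ι y) + closure D (M.ι y) := by
  rw [mem_H0_iff ((map_ne_zero_iff _ (functionFieldEquiv M.ι).injective).mpr hg0)]
  refine forall_congr' fun y => ?_
  rw [ord_functionFieldEquiv, closure_ι,
    show Order.coheight (M.ι y) = Order.coheight y from coheight_eq_of_isOpenImmersion M.ι]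

theorem SatisfiesX.exists_mem_H0 (h : SatisfiesX D) : ∃ g ∈ H0 D, g ≠ 0 := by
  obtain ⟨φ, -, s, hs, -, he⟩ := h
  obtain ⟨g, hg0, hg⟩ := he.exists_ne_zero hs
  refine ⟨functionFieldEquiv M.ι g, (functionFieldEquiv_mem_H0_iff hg0).mpr fun y hy => ?_,
    (map_ne_zero_iff _ (functionFieldEquiv M.ι).injective).mpr hg0⟩
  simpa only [Pi.add_apply, twist_ι, add_zero] using hg (M.ι y) hg0 (M.ι y) specializes_rfl hy

theorem satisfiesX_of_mem_H0 {g : M.X.functionField} (hg0 : g ≠ 0)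
    (hgD : functionFieldEquiv M.ι g ∈ H0 D) : SatisfiesX D := by
  rw [functionFieldEquiv_mem_H0_iff hg0] at hgD
  let φ : M.Component → ℤ := fun v => - Scheme.ord g v.1
  have hgv (v : M.Component) : Scheme.ord g v.1 + (closure D + twist φ) v.1 = 0 := by
    rw [Pi.add_apply, twist_component, closure_eq_zero D v.2.1, zero_add, add_neg_cancel]
  have hg (x : M.X) : g ∈ stalkO (closure D + twist φ) x := by
    intro _ z _ hz
    by_cases hfz : M.f z = IsLocalRing.closedPoint R
    · exact (hgv ⟨z, M.isComponent_of_coheight_eq_one hz hfz⟩).ge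
    · obtain ⟨y, rfl⟩ := M.range_ι.superset hfz
      rw [Pi.add_apply, twist_ι, add_zero]
      exact hgD y hz
  exact ⟨φ,
    nonnegDegrees_of_ord_add_eq_zero (finite_setOf_closure_add_twist_ne_zero D φ) hg0 hg hgv,
    restrictSections hg, restrictSections_nonzero hg hg0 hgv, restrictSections_agreeAtNodes hg,
    restrictSections_extends hg⟩

theorem satisfiesX_iff_exists_mem_H0 : SatisfiesX D ↔ ∃ g ∈ H0 D, g ≠ 0 := by
  refine ⟨SatisfiesX.exists_mem_H0, fun ⟨g', hgD, hg0⟩ => ?_⟩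
  obtain ⟨g, rfl⟩ := (functionFieldEquiv M.ι).surjective g'
  exact satisfiesX_of_mem_H0 (fun e => hg0 (by rw [e, map_zero])) hgD

end SatisfiesX

theorem algebraMap_stalkScalar (c : K) (z : M.genericFibre) :
    algebraMap _ M.genericFibre.functionField (stalkScalar M.toSpecK c z) =
      algebraMap K M.genericFibre.functionField c :=
  stalkSpecializes_stalkScalar M.toSpecK c (genericPoint_specializes z)

theorem exists_algebraMap_eq_of_isClosed {y : M.genericFibre}
    (hy : IsClosed ({y} : Set M.genericFibre)) {g : M.genericFibre.functionField} (hg0 : g ≠ 0)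
    (hg : 0 ≤ Scheme.ord g y) :
    ∃ a : M.genericFibre.presheaf.stalk y, algebraMap _ M.genericFibre.functionField a = g := by
  have hy1 := M.coheight_genericFibre_eq_one_of_isClosed hy
  have := uniqueFactorizationMonoid_stalk (hy1.le.trans one_le_two)
  refine exists_algebraMap_eq_of_ord_nonneg hg0 fun z hzy hz => ?_
  rwa [eq_of_specializes_of_coheight_eq_one hzy hz hy1]

namespace Points

theorem isClosed_pt (P : M.Points) : IsClosed ({P.pt} : Set M.genericFibre) := by
  have hcomp : IsClosedImmersion (P.1 ≫ M.toSpecK) := by rw [P.2]; infer_instance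
  have hP : IsClosedImmersion P.1 := IsClosedImmersion.of_comp P.1 M.toSpecK
  have hrange : Set.range P.1 = {P.pt} := by
    refine Set.Subset.antisymm ?_ (Set.singleton_subset_iff.mpr ⟨_, rfl⟩)
    rintro _ ⟨x, rfl⟩
    exact congrArg P.1 ((PrimeSpectrum.instUnique (R := K)).instSubsingleton.elim x _)
  rw [← hrange]
  exact P.1.isClosedEmbedding.isClosed_range

theorem coheight_pt (P : M.Points) : Order.coheight P.pt = 1 :=
  M.coheight_genericFibre_eq_one_of_isClosed P.isClosed_pt

/-- Evaluation of germs at a rational point. -/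
noncomputable def eval (P : M.Points) : M.genericFibre.presheaf.stalk P.pt →+* K :=
  (Scheme.stalkClosedPointTo P.1).hom

instance (P : M.Points) : IsLocalHom P.eval :=
  inferInstanceAs (IsLocalHom (Scheme.stalkClosedPointTo P.1).hom)

theorem eval_stalkScalar (P : M.Points) (c : K) : P.eval (stalkScalar M.toSpecK c P.pt) = c := by
  have hsection : M.toSpecK.appTop ≫ P.1.appTop = 𝟙 _ := by
    rw [← Scheme.Hom.comp_appTop, P.2]
    rfl
  have hgerm : M.genericFibre.presheaf.germ ⊤ P.pt trivial ≫ Scheme.stalkClosedPointTo P.1 =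
      P.1.appTop ≫ (Scheme.ΓSpecIso (.of K)).hom := by
    refine (Scheme.germ_stalkClosedPointTo P.1 ⊤ trivial).trans ?_
    simp only [TopologicalSpace.Opens.map_top, Iso.trans_hom, Functor.mapIso_hom, Iso.op_hom]
    rfl
  have hid : (Scheme.ΓSpecIso (.of K)).inv ≫ M.toSpecK.appTop ≫
      M.genericFibre.presheaf.germ ⊤ P.pt trivial ≫ Scheme.stalkClosedPointTo P.1 = 𝟙 _ := by
    rw [hgerm, ← Category.assoc M.toSpecK.appTop, hsection, Category.id_comp, Iso.inv_hom_id]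
  exact congrArg (fun φ => φ.hom c) hid

theorem mem_maximalIdeal_iff (P : M.Points) (u : M.genericFibre.presheaf.stalk P.pt) :
    u ∈ IsLocalRing.maximalIdeal (M.genericFibre.presheaf.stalk P.pt) ↔ P.eval u = 0 := by
  rw [IsLocalRing.mem_maximalIdeal, mem_nonunits_iff, ← isUnit_map_iff P.eval, isUnit_iff_ne_zero,
    not_not]

theorem sub_stalkScalar_eval_mem_maximalIdeal (P : M.Points)
    (u : M.genericFibre.presheaf.stalk P.pt) :
    u - stalkScalar M.toSpecK (P.eval u) P.pt ∈
      IsLocalRing.maximalIdeal (M.genericFibre.presheaf.stalk P.pt) := by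
  rw [mem_maximalIdeal_iff, map_sub, eval_stalkScalar, sub_self]

theorem pt_injective : Function.Injective (pt : M.Points → M.genericFibre) := by
  intro P Q h
  refine Subtype.ext ((SpecToEquivOfLocalRing M.genericFibre (.of K)).injective
    (SpecToEquivOfLocalRing_eq_iff.mpr ⟨h, ?_⟩))
  refine CommRingCat.hom_ext (RingHom.ext fun (u : M.genericFibre.presheaf.stalk P.pt) => ?_)
  have hQP : Q.pt ⤳ P.pt := specializes_of_eq h.symm
  change P.eval u = Q.eval ((M.genericFibre.presheaf.stalkSpecializes hQP).hom u)
  have hu : u - stalkScalar M.toSpecK (P.eval u) P.pt ∈ primeAt hQP := by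
    rw [(primeAt_inj (hz := specializes_rfl)).mpr h.symm, primeAt_refl]
    exact P.sub_stalkScalar_eval_mem_maximalIdeal u
  have heval := (Q.mem_maximalIdeal_iff _).mp hu
  rw [map_sub, map_sub, stalkSpecializes_stalkScalar, eval_stalkScalar, sub_eq_zero] at heval
  exact heval.symm

theorem exists_one_le_ord_sub_algebraMap (P : M.Points) {g : M.genericFibre.functionField}
    (hg0 : g ≠ 0) (hg : 0 ≤ Scheme.ord g P.pt) :
    ∃ c : K, g - algebraMap K _ c ≠ 0 → 1 ≤ Scheme.ord (g - algebraMap K _ c) P.pt := by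
  obtain ⟨u, rfl⟩ := exists_algebraMap_eq_of_isClosed P.isClosed_pt hg0 hg
  refine ⟨P.eval u, fun hne => ?_⟩
  rw [← algebraMap_stalkScalar (P.eval u) P.pt, ← map_sub] at hne ⊢
  have hne' : u - stalkScalar M.toSpecK (P.eval u) P.pt ≠ 0 := fun e => hne (by rw [e, map_zero])
  have hord_ne := (ord_algebraMap_ne_zero_iff specializes_rfl P.coheight_pt hne').mpr (by
    rw [primeAt_refl]
    exact P.sub_stalkScalar_eval_mem_maximalIdeal u)
  have hord_nonneg := ord_algebraMap_nonneg (specializes_refl P.pt) hne'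
  omega

end Points

section H0

theorem genericDivisor_sub (D E : M.Div) :
    genericDivisor (D - E) = genericDivisor D - genericDivisor E :=
  funext fun _ => Finsupp.sum_sub_index fun _ _ _ => by split_ifs <;> simp

theorem genericDivisor_mono : Monotone (genericDivisor : M.Div → M.genericFibre → ℤ) := by
  intro D D' h
  rw [← sub_nonneg, ← genericDivisor_sub]
  refine fun z => Finset.sum_nonneg fun P _ => ?_
  dsimp only
  split_ifs
  exacts [sub_nonneg.mpr h P, le_rfl]

theorem genericDivisor_pt (D : M.Div) (P : M.Points) : genericDivisor D P.pt = D P := by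
  classical
  simp [genericDivisor, Finsupp.sum, Points.pt_injective.eq_iff, eq_comm]

open Classical in
theorem genericDivisor_single (P : M.Points) (n : ℤ) (z : M.genericFibre) :
    genericDivisor (Finsupp.single P n) z = if P.pt = z then n else 0 :=
  Finsupp.sum_single_index (ite_self 0)

theorem H0_mono : Monotone (H0 : M.Div → Submodule K M.genericFibre.functionField) := by
  intro D D' h g hg
  obtain rfl | hg0 := eq_or_ne g 0
  · exact zero_mem _
  rw [mem_H0_iff hg0] at hg ⊢
  exact fun z hz => (hg z hz).trans (add_le_add_right (genericDivisor_mono h z) _)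

theorem mem_H0_sub_single_iff {D : M.Div} {P : M.Points} {g : M.genericFibre.functionField}
    (hg0 : g ≠ 0) : g ∈ H0 (D - Finsupp.single P 1) ↔
      g ∈ H0 D ∧ 1 ≤ Scheme.ord g P.pt + D P := by
  rw [mem_H0_iff hg0, mem_H0_iff hg0, ← genericDivisor_pt]
  simp only [genericDivisor_sub, Pi.sub_apply, genericDivisor_single]
  refine ⟨fun h => ⟨fun z hz => ?_, ?_⟩, fun ⟨hD, hP⟩ z hz => ?_⟩
  · have := h z hz
    split_ifs at this <;> omega
  · have := h P.pt P.coheight_pt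
    rw [if_pos rfl] at this
    omega
  · split_ifs with hPz
    · subst hPz
      omega
    · simpa only [sub_zero] using hD z hz

theorem exists_sub_smul_mem_H0 {D : M.Div} {P : M.Points} {g₁ g₂ : M.genericFibre.functionField}
    (h₁ : g₁ ∈ H0 D) (h₂ : g₂ ∈ H0 D) (h₂' : g₂ ∉ H0 (D - Finsupp.single P 1)) :
    ∃ c : K, g₁ - c • g₂ ∈ H0 (D - Finsupp.single P 1) := by
  obtain rfl | hg₁ := eq_or_ne g₁ 0
  · exact ⟨0, by rw [zero_smul, sub_zero]; exact zero_mem _⟩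
  have hg₂ : g₂ ≠ 0 := fun e => h₂' (e ▸ zero_mem _)
  have hord₁ := (mem_H0_iff hg₁).mp h₁ P.pt P.coheight_pt
  rw [mem_H0_sub_single_iff hg₂, not_and] at h₂'
  have hord₂ := h₂' h₂
  rw [genericDivisor_pt] at hord₁
  obtain ⟨c, hc⟩ := P.exists_one_le_ord_sub_algebraMap (mul_ne_zero hg₁ (inv_ne_zero hg₂)) (by
    rw [Scheme.ord_mul hg₁ (inv_ne_zero hg₂), ord_inv hg₂]
    omega)
  have hfactor : g₁ - c • g₂ = (g₁ * g₂⁻¹ - algebraMap K _ c) * g₂ := by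
    rw [sub_mul, inv_mul_cancel_right₀ hg₂, Algebra.smul_def]
  refine ⟨c, ?_⟩
  obtain h0 | hne := eq_or_ne (g₁ - c • g₂) 0
  · exact h0 ▸ zero_mem _
  have hne' : g₁ * g₂⁻¹ - algebraMap K _ c ≠ 0 := fun e => hne (by rw [hfactor, e, zero_mul])
  refine (mem_H0_sub_single_iff hne).mpr ⟨sub_mem h₁ (Submodule.smul_mem _ _ h₂), ?_⟩
  rw [hfactor, Scheme.ord_mul hne' hg₂]
  have hord := hc hne'
  have hord₂_nonneg := (mem_H0_iff hg₂).mp h₂ P.pt P.coheight_pt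
  rw [genericDivisor_pt] at hord₂_nonneg
  omega

theorem exists_H0_le_sup_span (D : M.Div) (P : M.Points) :
    ∃ g : M.genericFibre.functionField,
      H0 D ≤ H0 (D - Finsupp.single P 1) ⊔ Submodule.span K {g} := by
  by_cases h : ∃ g ∈ H0 D, g ∉ H0 (D - Finsupp.single P 1)
  · obtain ⟨g, hg, hg'⟩ := h
    refine ⟨g, fun g₁ hg₁ => ?_⟩
    obtain ⟨c, hc⟩ := exists_sub_smul_mem_H0 hg₁ hg hg'
    rw [← sub_add_cancel g₁ (c • g)]
    exact Submodule.add_mem_sup hc (Submodule.smul_mem _ _ (Submodule.mem_span_singleton_self g))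
  · push Not at h
    exact ⟨0, le_sup_of_le_left h⟩

theorem exists_germ_eq_of_mem_H0_zero {g : M.genericFibre.functionField}
    (hg : g ∈ H0 (0 : M.Div)) : ∃ s : Γ(M.genericFibre, ⊤),
      M.genericFibre.presheaf.germ ⊤ (genericPoint M.genericFibre) trivial s = g := by
  obtain rfl | hg0 := eq_or_ne g 0
  · exact ⟨0, map_zero _⟩
  refine exists_germ_genericPoint_eq g fun x => ?_
  obtain ⟨y, hy, hycl⟩ := isClosed_closure.exists_closed_singleton
    (⟨x, subset_closure rfl⟩ : (_root_.closure {x} : Set M.genericFibre).Nonempty)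
  have hord := (mem_H0_iff hg0).mp hg y (M.coheight_genericFibre_eq_one_of_isClosed hycl)
  rw [show genericDivisor (0 : M.Div) y = 0 from Finsupp.sum_zero_index, add_zero] at hord
  obtain ⟨a, ha⟩ := exists_algebraMap_eq_of_isClosed hycl hg0 hord
  exact ⟨_, (algebraMap_stalkSpecializes (specializes_iff_mem_closure.mpr hy) a).trans ha⟩

theorem finite_H0_zero : Module.Finite K (H0 (0 : M.Div)) := by
  let ψ : CommRingCat.of K ⟶ Γ(M.genericFibre, ⊤) :=
    (Scheme.ΓSpecIso (.of K)).inv ≫ M.toSpecK.appTop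
  have hψ : ψ.hom.Finite := by
    rw [CommRingCat.hom_comp]
    exact (finite_appTop_of_universallyClosed K M.toSpecK).comp
      (RingHom.Finite.of_surjective _
        (Scheme.ΓSpecIso (.of K)).symm.commRingCatIsoToRingEquiv.surjective)
  let := ψ.hom.toAlgebra
  have : Module.Finite K Γ(M.genericFibre, ⊤) := hψ
  let θ : Γ(M.genericFibre, ⊤) →ₗ[K] M.genericFibre.functionField :=
    { toFun := M.genericFibre.presheaf.germ ⊤ (genericPoint M.genericFibre) trivial
      map_add' := map_add _
      map_smul' := fun c s => by
        rw [Algebra.smul_def, map_mul, RingHom.id_apply, Algebra.smul_def]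
        rfl }
  have hle : H0 (0 : M.Div) ≤ LinearMap.range θ := fun g hg => exists_germ_eq_of_mem_H0_zero hg
  exact Submodule.finiteDimensional_of_le hle

theorem finite_H0_iff_sub_single (D : M.Div) (P : M.Points) :
    Module.Finite K (H0 D) ↔ Module.Finite K (H0 (D - Finsupp.single P 1)) := by
  have hle : H0 (D - Finsupp.single P 1) ≤ H0 D :=
    H0_mono (sub_le_self D (Finsupp.single_nonneg.mpr zero_le_one))
  obtain ⟨g, hg⟩ := exists_H0_le_sup_span D P
  exact ⟨fun _ => Submodule.finiteDimensional_of_le hle,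
    fun _ => Submodule.finiteDimensional_of_le hg⟩

theorem finite_H0_iff_single_add (D : M.Div) (P : M.Points) (n : ℤ) :
    Module.Finite K (H0 (Finsupp.single P n + D)) ↔ Module.Finite K (H0 D) := by
  induction n with
  | zero => rw [Finsupp.single_zero, zero_add]
  | succ n ih =>
    rw [finite_H0_iff_sub_single _ P, ← ih, Finsupp.single_add, add_right_comm,
      add_sub_cancel_right]
  | pred n ih =>
    rw [← ih, finite_H0_iff_sub_single (Finsupp.single P (-(n : ℤ)) + D) P, Finsupp.single_sub,
      sub_add_eq_add_sub]

instance finite_H0 (D : M.Div) : Module.Finite K (H0 D) := by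
  induction D using Finsupp.induction with
  | zero => exact finite_H0_zero
  | single_add P n D _ _ ih => exact (finite_H0_iff_single_add D P n).mpr ih

end H0

section Degree

theorem deg_add (D E : M.Div) : deg (D + E) = deg D + deg E :=
  Finsupp.sum_add_index' (fun _ => rfl) fun _ _ _ => rfl

theorem deg_single (P : M.Points) (n : ℤ) : deg (Finsupp.single P n : M.Div) = n :=
  Finsupp.sum_single_index rfl

theorem deg_nonneg {E : M.Div} (hE : 0 ≤ E) : 0 ≤ deg E :=
  Finset.sum_nonneg fun P _ => hE P

theorem eq_zero_of_deg_eq_zero {E : M.Div} (hE : 0 ≤ E) (hdeg : deg E = 0) : E = 0 := by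
  ext P
  by_cases hP : P ∈ E.support
  · exact (Finset.sum_eq_zero_iff_of_nonneg fun Q _ => hE Q).mp hdeg P hP
  · exact Finsupp.notMem_support_iff.mp hP

theorem exists_eq_add_single {E : M.Div} (hE : 0 ≤ E) (hdeg : 0 < deg E) :
    ∃ (P : M.Points) (E' : M.Div), 0 ≤ E' ∧ E = E' + Finsupp.single P 1 := by
  obtain ⟨P, hP⟩ : ∃ P, E P ≠ 0 := by
    by_contra! h
    exact hdeg.ne' (Finset.sum_eq_zero fun P _ => h P)
  refine ⟨P, E - Finsupp.single P 1, sub_nonneg.mpr fun Q => ?_, (sub_add_cancel _ _).symm⟩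
  classical
  rw [Finsupp.single_apply]
  split_ifs with hPQ
  · exact Int.add_one_le_of_lt (lt_of_le_of_ne (hE Q) (hPQ ▸ hP.symm))
  · exact hE Q

end Degree

section Rank

theorem rank_mono : Monotone (rank : (M.Div → Prop) → M.Div → EReal) :=
  fun _ _ hST _ => le_iInf fun E => iInf_le_of_le ⟨E.1, E.2.1, fun hS => E.2.2 (hST _ hS)⟩ le_rfl

theorem HasRank.rank_eq [Nonempty M.Points] {S : M.Div → Prop} (hS : Monotone S) {D : M.Div}
    {r : ℤ} (h : HasRank S D r) : rank S D = ((r : ℝ) : EReal) := by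
  obtain ⟨P⟩ := ‹Nonempty M.Points›
  obtain ⟨rfl, hD⟩ | ⟨-, hle, E, hE, hdeg, hfail⟩ := h
  · refine le_antisymm (iInf_le_of_le ⟨0, le_rfl, by rwa [sub_zero]⟩ ?_) (le_iInf fun E => ?_)
    · simp [deg]
    · have := deg_nonneg E.2.1
      exact_mod_cast (by omega : -1 ≤ deg E.1 - 1)
  · refine le_antisymm (iInf_le_of_le ⟨E, hE, hfail⟩ ?_) (le_iInf fun ⟨E', hE', hfail'⟩ => ?_)
    · exact_mod_cast (by omega : deg E - 1 ≤ r)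
    · suffices r < deg E' by exact_mod_cast (by omega : r ≤ deg E' - 1)
      by_contra! hlt
      have hpad : 0 ≤ (Finsupp.single P (r - deg E') : M.Div) :=
        Finsupp.single_nonneg.mpr (by omega)
      refine hfail' (hS (sub_le_sub_left (le_add_of_nonneg_right hpad) D)
        (hle _ (add_nonneg hE' hpad) ?_))
      rw [deg_add, deg_single, add_sub_cancel]

theorem HasRank.unique [Nonempty M.Points] {S : M.Div → Prop} (hS : Monotone S) {D : M.Div}
    {r r' : ℤ} (h : HasRank S D r) (h' : HasRank S D r') : r = r' := by
  exact_mod_cast (h.rank_eq hS).symm.trans (h'.rank_eq hS)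

end Rank

section GlobalSections

/-- The dimension `h⁰(D)` of the space `H⁰(X, 𝒪(D))` of global sections over `K`. -/
noncomputable def h0 (D : M.Div) : ℕ := Module.finrank K (H0 D)

theorem satisfiesX_iff_h0_pos {D : M.Div} : SatisfiesX D ↔ 0 < h0 D := by
  rw [satisfiesX_iff_exists_mem_H0, h0, Module.finrank_pos_iff, Submodule.nontrivial_iff_ne_bot,
    Submodule.ne_bot_iff]

theorem monotone_satisfiesX : Monotone (SatisfiesX : M.Div → Prop) := by
  intro D D' h hD
  rw [satisfiesX_iff_h0_pos] at hD ⊢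
  exact hD.trans_le (Submodule.finrank_mono (H0_mono h))

theorem h0_le_h0_sub_single_add_one (D : M.Div) (P : M.Points) :
    h0 D ≤ h0 (D - Finsupp.single P 1) + 1 := by
  obtain ⟨g, hg⟩ := exists_H0_le_sup_span D P
  have hspan : Module.finrank K (Submodule.span K {g}) ≤ 1 :=
    (finrank_span_le_card {g}).trans_eq (by rw [Set.toFinset_singleton, Finset.card_singleton])
  calc h0 D ≤ _ := Submodule.finrank_mono hg
    _ ≤ _ := Submodule.finrank_add_le_finrank_add_finrank _ _
    _ ≤ h0 (D - Finsupp.single P 1) + 1 := Nat.add_le_add_left hspan _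

theorem h0_le_h0_sub_add (D : M.Div) {n : ℕ} {E : M.Div} (hE : 0 ≤ E) (hdeg : deg E = n) :
    h0 D ≤ h0 (D - E) + n := by
  induction n generalizing E with
  | zero => rw [eq_zero_of_deg_eq_zero hE hdeg, sub_zero, add_zero]
  | succ n ih =>
    obtain ⟨P, E', hE', rfl⟩ := exists_eq_add_single hE (by omega)
    rw [deg_add, deg_single, Nat.cast_succ, add_left_inj] at hdeg
    have hP := h0_le_h0_sub_single_add_one (D - E') P
    rw [sub_sub] at hP
    have := ih hE' hdeg
    omega

theorem exists_h0_sub_single_add_one_eq [Infinite M.Points] {D : M.Div} (hD : 0 < h0 D) :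
    ∃ P : M.Points, h0 (D - Finsupp.single P 1) + 1 = h0 D := by
  obtain ⟨g, hg, hg0⟩ := satisfiesX_iff_exists_mem_H0.mp (satisfiesX_iff_h0_pos.mpr hD)
  have hfin : (Points.pt ⁻¹' {z : M.genericFibre | Scheme.ord g z ≠ 0} ∪ D.support).Finite :=
    ((finite_setOf_ord_ne_zero g).preimage Points.pt_injective.injOn).union D.support.finite_toSet
  obtain ⟨P, hP⟩ := hfin.exists_notMem
  rw [Set.mem_union, not_or] at hP
  have hordP : Scheme.ord g P.pt = 0 := not_not.mp hP.1
  have hDP : D P = 0 := Finsupp.notMem_support_iff.mp hP.2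
  have hgP : g ∉ H0 (D - Finsupp.single P 1) := by
    rw [mem_H0_sub_single_iff hg0, hordP, hDP]
    omega
  have hlt : H0 (D - Finsupp.single P 1) < H0 D :=
    SetLike.lt_iff_le_and_exists.mpr ⟨H0_mono (sub_le_self D
      (Finsupp.single_nonneg.mpr zero_le_one)), g, hg, hgP⟩
  exact ⟨P, le_antisymm (Submodule.finrank_lt_finrank_of_lt hlt)
    (h0_le_h0_sub_single_add_one D P)⟩

theorem exists_h0_sub_add_eq [Infinite M.Points] (D : M.Div) {n : ℕ} (hn : n ≤ h0 D) :
    ∃ E : M.Div, 0 ≤ E ∧ deg E = n ∧ h0 (D - E) + n = h0 D := by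
  induction n with
  | zero => exact ⟨0, le_rfl, Finsupp.sum_zero_index, by rw [sub_zero, add_zero]⟩
  | succ n ih =>
    obtain ⟨E, hE, hdeg, h⟩ := ih (by omega)
    obtain ⟨P, hP⟩ := exists_h0_sub_single_add_one_eq (D := D - E) (by omega)
    rw [sub_sub] at hP
    refine ⟨E + Finsupp.single P 1, add_nonneg hE (Finsupp.single_nonneg.mpr zero_le_one), ?_, ?_⟩
    · rw [deg_add, deg_single, hdeg, Nat.cast_succ]
    · omega

theorem hasRank_satisfiesX [Infinite M.Points] (D : M.Div) :
    HasRank SatisfiesX D ((h0 D : ℤ) - 1) := by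
  obtain h | h := (h0 D).eq_zero_or_pos
  · exact Or.inl ⟨by omega, by rw [satisfiesX_iff_h0_pos]; omega⟩
  refine Or.inr ⟨by omega, fun E hE hdeg => ?_, ?_⟩
  · have := h0_le_h0_sub_add D (n := h0 D - 1) hE (by omega)
    rw [satisfiesX_iff_h0_pos]
    omega
  · obtain ⟨E, hE, hdeg, h⟩ := exists_h0_sub_add_eq D le_rfl
    exact ⟨E, hE, by omega, by rw [satisfiesX_iff_h0_pos]; omega⟩

end GlobalSections

end RegularSemistableModel

end GeomRank

theorem proposition3p7 {R K : Type u} [CommRing R] [IsDomain R] [IsDiscreteValuationRing R]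
    [Field K] [Algebra R K] [IsFractionRing R K]
    (M : GeomRank.RegularSemistableModel R K) (hinf : Infinite M.Points) (D : M.Div) :
    Module.Finite K (GeomRank.RegularSemistableModel.H0 D) ∧
    (∀ r : ℤ,
      GeomRank.RegularSemistableModel.HasRank GeomRank.RegularSemistableModel.SatisfiesX D r ↔
        r = (Module.finrank K (GeomRank.RegularSemistableModel.H0 D) : ℤ) - 1) ∧
    GeomRank.RegularSemistableModel.rX D =
      (((Module.finrank K (GeomRank.RegularSemistableModel.H0 D) : ℤ) - 1 : ℤ) : ℝ) ∧
    GeomRank.RegularSemistableModel.rX D ≤ GeomRank.RegularSemistableModel.rToric D ∧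
    GeomRank.RegularSemistableModel.rToric D ≤ GeomRank.RegularSemistableModel.rAb D ∧
    GeomRank.RegularSemistableModel.rAb D ≤ GeomRank.RegularSemistableModel.rNum D := by
  open GeomRank RegularSemistableModel in
  have hX : HasRank SatisfiesX D ((h0 D : ℤ) - 1) := hasRank_satisfiesX D
  exact ⟨finite_H0 D,
    fun r => ⟨fun hr => hr.unique monotone_satisfiesX hX, fun hr => hr ▸ hX⟩,
    hX.rank_eq monotone_satisfiesX,
    rank_mono (fun _ ⟨φ, hdeg, s, hne, hnode, _⟩ => ⟨φ, hdeg, s, hne, hnode⟩) D,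
    rank_mono (fun _ ⟨φ, hdeg, s, hne, _⟩ => ⟨φ, hdeg, s, hne⟩) D,
    rank_mono (fun _ ⟨φ, hdeg, _⟩ => ⟨φ, hdeg⟩) D⟩
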